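/- Let $d\ge 2$ and $\rho\in(0,1)$, and let $\|\cdot\|$ and $\langle\cdot,\cdot\rangle$ be the Euclidean norm and inner product on $\mathbb{R}^d$. Let $\Pi(\mathrm{d}x)=\pi(x)\,\mathrm{d}x$ be a probability measure on $\mathbb{R}^d$ with a strictly positive density $\pi$. The MpCN kernel $P$ with target $\Pi$ is the Metropolis–Hastings kernel $$P(x,\mathrm{d}y)=Q(x,\mathrm{d}y)\,a(x,y)+\delta_x(\mathrm{d}y)\Big(1-\int Q(x,\mathrm{d}z)\,a(x,z)\Big),\qquad a(x,y)=\min\Big\{1,\frac{\pi(y)\|x\|^{-d}}{\pi(x)\|y\|^{-d}}\Big\},$$ where, for $x\neq0$, the proposal $Q(x,\cdot)$ is the law of $\rho^{1/2}x+(1-\rho)^{1/2}r^{-1/2}w$ with $w\sim N_d(0,I_d)$ and $r\sim\mathrm{Gamma}(d/2,\|x\|^2/2)$ (shape and rate) independent, and $Q(0,\cdot)=\delta_0$. Say that $P$ is geometrically ergodic if there are a measurable function $V:\mathbb{R}^d\to[1,\infty]$ that is finite $\Pi$-almost surely, a number $\gamma\in(0,1)$ and a constant $c<\infty$ such that $$\|P^n(x,\cdot)-\Pi\|_V\le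 c\,\gamma^n\,V(x)\qquad\text{for all }n\ge 0\text{ and }x\in\mathbb{R}^d,$$ where $\|\nu\|_V=\sup_{|f|\le V}\big|\int f\,\mathrm{d}\nu\big|$. Theorem. The MpCN kernel with target $\Pi$ is geometrically ergodic if $\pi$ belongs to one of the following two classes. 1. (Heavy-tailed class) $\pi$ is continuous and, for some unit vector $e\in\mathbb{R}^d$ and some $\alpha>d$, $$\lim_{r\to\infty}\frac{\pi(rx)}{\pi(re)}=\|x\|^{-\alpha}\qquad\text{locally uniformly in }x\in\mathbb{R}^d\setminus\{0\}.$$ 2. (Light-tailed class) $\pi$ is differentiable; for every $x\ne0$ and $s>0$, $$\lim_{r\to\infty}\frac{\pi(rsx)}{\pi(rx)}=\begin{cases}0&\text{if }s>1,\\+\infty&\text{if }s<1;\end{cases}$$ and $$\limsup_{\|x\|\to\infty}\left\langle\frac{x}{\|x\|},\frac{\nabla\log\pi(x)}{\|\nabla\log\pi(x)\|}\right\rangle<0 .$$ -/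

import Mathlib

open MeasureTheory ProbabilityTheory Filter Topology
open scoped ENNReal

/-- `ℝ^d` with the Euclidean norm and inner product. -/
abbrev RSpace (d : ℕ) : Type := EuclideanSpace ℝ (Fin d)

/-! ### Metropolis–Hastings kernels with reversible proposal -/

section MetropolisHastings

variable {E : Type*} [MeasurableSpace E]

/-- Acceptance probability `min {1, p y * p' x / (p x * p' y)}`, where `p` is the density of the
target and `p'` the density of the measure for which the proposal is reversible. -/
noncomputable def acceptProb (p p' : E → ℝ) (x y : E) : ℝ≥0∞ :=
  ENNReal.ofReal (min 1 ((p y * p' x) / (p x * p' y)))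

theorem measurable_acceptProb {p p' : E → ℝ} (hp : Measurable p) (hp' : Measurable p') :
    Measurable (Function.uncurry (acceptProb p p')) := by
  unfold acceptProb Function.uncurry
  fun_prop

/-- The Metropolis–Hastings kernel
`P(x, dy) = Q(x, dy) a(x, y) + δ_x(dy) (1 - ∫ Q(x, dz) a(x, z))`. -/
noncomputable def mhKernel (Q : Kernel E E) [IsMarkovKernel Q] (p p' : E → ℝ)
    (hp : Measurable p) (hp' : Measurable p') : Kernel E E where
  toFun x := (Q x).withDensity (acceptProb p p' x) +
    (1 - ∫⁻ z, acceptProb p p' x z ∂(Q x)) • Measure.dirac x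
  measurable' := by
    have ha := measurable_acceptProb hp hp'
    have h1 : Measurable fun x => (Q x).withDensity (acceptProb p p' x) := by
      have h := (Kernel.withDensity Q (acceptProb p p')).measurable
      have e : (⇑(Kernel.withDensity Q (acceptProb p p'))) =
          fun x => (Q x).withDensity (acceptProb p p' x) := by
        funext x
        exact Kernel.withDensity_apply Q ha x
      rwa [e] at h
    have h2 : Measurable fun x => ∫⁻ z, acceptProb p p' x z ∂(Q x) :=
      Measurable.lintegral_kernel_prod_right ha
    refine Measure.measurable_of_measurable_coe _ fun s hs => ?_
    simp only [Measure.add_apply, Measure.smul_apply, smul_eq_mul]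
    refine Measurable.add ((Measure.measurable_coe hs).comp h1) ?_
    exact (measurable_const.sub h2).mul ((Measure.measurable_coe hs).comp Measure.measurable_dirac)

/-- The `V`-norm `‖μ - ν‖_V`, the supremum of `|∫ f dμ - ∫ f dν|` over the measurable `f` with
`|f| ≤ V` for which both integrals exist (every bounded `f` is among them). -/
noncomputable def vNormDist (V : E → ℝ≥0∞) (μ ν : Measure E) : ℝ≥0∞ :=
  ⨆ (f : E → ℝ) (_ : Measurable f) (_ : ∀ y, ENNReal.ofReal |f y| ≤ V y)
    (_ : Integrable f μ) (_ : Integrable f ν), ENNReal.ofReal |∫ y, f y ∂μ - ∫ y, f y ∂ν|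

/-- Geometric ergodicity: for some `V : E → [1, ∞]` that is finite `Pi`-almost surely, some
`γ ∈ (0, 1)` and some constant `c`, one has `‖P^n(x, ·) - Pi‖_V ≤ c γ^n V(x)` for all `n`, `x`. -/
def GeometricallyErgodic (P : Kernel E E) (Pi : Measure E) : Prop :=
  ∃ V : E → ℝ≥0∞, Measurable V ∧ (∀ x, 1 ≤ V x) ∧ (∀ᵐ x ∂Pi, V x < ∞) ∧
    ∃ γ c : ℝ, 0 < γ ∧ γ < 1 ∧ 0 < c ∧
      ∀ (n : ℕ) (x : E), vNormDist V ((P ^ n) x) Pi ≤ ENNReal.ofReal (c * γ ^ n) * V x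

end MetropolisHastings

/-! ### The MpCN kernel -/

/-- The MpCN proposal: the law of `√ρ x + √(1 - ρ) r^{-1/2} w` for independent
`r ∼ Gamma(d/2, ‖x‖²/2)` (shape, rate) and `w ∼ N_d(0, I_d)`.  At the origin, where the rate of the
Gamma law degenerates, the proposal stays at the origin (the law of
`√ρ x + √(1 - ρ) ‖x‖ w / ‖w'‖` at `x = 0`, with `w'` an independent copy of `w`). -/
noncomputable def mpcnProposalMeasure (d : ℕ) (ρ : ℝ) (x : RSpace d) : Measure (RSpace d) :=
  open Classical in
  if x = 0 then Measure.dirac 0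
  else ((gammaMeasure ((d : ℝ) / 2) (‖x‖ ^ 2 / 2)).prod (stdGaussian (RSpace d))).map
    fun q => √ρ • x + √(1 - ρ) • (q.1 ^ (-(1 / 2) : ℝ)) • q.2

theorem measurable_mpcnProposalMeasure (d : ℕ) (ρ : ℝ) :
    Measurable (mpcnProposalMeasure d ρ) := by
  have hpdf : Measurable (Function.uncurry fun (x : RSpace d) (r : ℝ) =>
      gammaPDF ((d : ℝ) / 2) (‖x‖ ^ 2 / 2) r) := by
    unfold gammaPDF gammaPDFReal Function.uncurry
    refine ENNReal.measurable_ofReal.comp (Measurable.ite ?_ (by fun_prop) measurable_const)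
    exact measurableSet_le measurable_const measurable_snd
  let G : Kernel (RSpace d) ℝ := Kernel.withDensity (Kernel.const (RSpace d) volume)
    fun x r => gammaPDF ((d : ℝ) / 2) (‖x‖ ^ 2 / 2) r
  have hG : ∀ x, G x = gammaMeasure ((d : ℝ) / 2) (‖x‖ ^ 2 / 2) := fun x => by
    rw [Kernel.withDensity_apply _ hpdf, Kernel.const_apply]
    rfl
  have hGs : IsSFiniteKernel G :=
    Kernel.IsSFiniteKernel.withDensity _ fun _ _ => ENNReal.ofReal_ne_top
  let K : Kernel (RSpace d) (ℝ × RSpace d) :=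
    G ×ₖ Kernel.const (RSpace d) (stdGaussian (RSpace d))
  have hf : Measurable fun z : RSpace d × (ℝ × RSpace d) =>
      √ρ • z.1 + √(1 - ρ) • (z.2.1 ^ (-(1 / 2) : ℝ)) • z.2.2 := by fun_prop
  unfold mpcnProposalMeasure
  refine Measurable.ite (measurableSet_singleton (0 : RSpace d)) measurable_const ?_
  refine Measure.measurable_of_measurable_coe _ fun s hs => ?_
  have h := Kernel.measurable_kernel_prodMk_left (κ := K) (hf hs)
  convert h using 2 with x
  rw [Measure.map_apply (by fun_prop) hs]
  simp only [K, Kernel.prod_apply, hG, Kernel.const_apply]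
  rfl

/-- The MpCN proposal kernel. -/
noncomputable def mpcnProposal (d : ℕ) (ρ : ℝ) : Kernel (RSpace d) (RSpace d) where
  toFun := mpcnProposalMeasure d ρ
  measurable' := measurable_mpcnProposalMeasure d ρ

instance isMarkovKernel_mpcnProposal (d : ℕ) (ρ : ℝ) :
    IsMarkovKernel (mpcnProposal d ρ) := by
  refine ⟨fun x => ?_⟩
  change IsProbabilityMeasure (mpcnProposalMeasure d ρ x)
  unfold mpcnProposalMeasure
  split_ifs with hx
  · infer_instance
  · have hd : 0 < d := by
      rcases Nat.eq_zero_or_pos d with h | h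
      · subst h
        exact absurd (Subsingleton.elim x 0) hx
      · exact h
    have hx' : 0 < ‖x‖ := norm_pos_iff.mpr hx
    have := isProbabilityMeasure_gammaMeasure (a := (d : ℝ) / 2) (r := ‖x‖ ^ 2 / 2)
      (by positivity) (by positivity)
    exact Measure.isProbabilityMeasure_map (Measurable.aemeasurable (by fun_prop))

/-- The MpCN kernel for the target density `p`: the Metropolis–Hastings kernel with the MpCN
proposal, which is reversible for `‖x‖^{-d} dx`.  (The value of `‖x‖^{-d}` at the origin is
immaterial: the proposal started at `x ≠ 0` does not charge the origin, and the proposal started at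
the origin stays there.) -/
noncomputable def mpcnKernel (d : ℕ) (ρ : ℝ) (p : RSpace d → ℝ) (hp : Measurable p) :
    Kernel (RSpace d) (RSpace d) :=
  mhKernel (mpcnProposal d ρ) p (fun x => (‖x‖ ^ d)⁻¹) hp (by fun_prop)

/-! ### The target distributions -/

/-- The measure `Π(dx) = p(x) dx`. -/
noncomputable def targetMeasure {d : ℕ} (p : RSpace d → ℝ) : Measure (RSpace d) :=
  volume.withDensity fun x => ENNReal.ofReal (p x)

/-- Heavy-tailed class: `p` is positive, continuous and, for a unit vector `e` and some `α > d`,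
`p (r x) / p (r e) → ‖x‖^{-α}` as `r → ∞`, locally uniformly in `x ≠ 0`. -/
def HeavyTailedClass {d : ℕ} (p : RSpace d → ℝ) : Prop :=
  (∀ x, 0 < p x) ∧ Continuous p ∧
    ∃ e : RSpace d, ‖e‖ = 1 ∧ ∃ α : ℝ, (d : ℝ) < α ∧
      TendstoLocallyUniformlyOn (fun (r : ℝ) (x : RSpace d) => p (r • x) / p (r • e))
        (fun x => ‖x‖ ^ (-α)) atTop {0}ᶜ

/-- Rapid variation along every ray. -/
def RapidlyVarying {d : ℕ} (p : RSpace d → ℝ) : Prop :=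
  ∀ x : RSpace d, x ≠ 0 → ∀ s : ℝ, 0 < s →
    (1 < s → Tendsto (fun r : ℝ => p ((r * s) • x) / p (r • x)) atTop (𝓝 0)) ∧
    (s < 1 → Tendsto (fun r : ℝ => p ((r * s) • x) / p (r • x)) atTop atTop)

/-- Curvature condition `limsup_{‖x‖ → ∞} ⟨x / ‖x‖, ∇ log p(x) / ‖∇ log p(x)‖⟩ < 0`.  (The function
takes values in `[-1, 1]`, and it is `0` where the gradient vanishes, so the condition forces
`∇ log p(x) ≠ 0` for all large `x`.) -/
def CurvatureCondition {d : ℕ} (p : RSpace d → ℝ) : Prop :=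
  limsup (fun x : RSpace d =>
    inner ℝ (‖x‖⁻¹ • x)
      (‖gradient (fun y => Real.log (p y)) x‖⁻¹ • gradient (fun y => Real.log (p y)) x))
    (Bornology.cobounded (RSpace d)) < 0

/-- Light-tailed class. -/
def LightTailedClass {d : ℕ} (p : RSpace d → ℝ) : Prop :=
  (∀ x, 0 < p x) ∧ Differentiable ℝ p ∧ RapidlyVarying p ∧ CurvatureCondition p

/-! ### The Harris theorem: drift and minorization imply geometric ergodicity -/

section Harris

variable {E : Type*} [MeasurableSpace E]

/-! Write `w(x) = p(x) ‖x‖^d` for the density of the target with respect to `‖x‖^{-d} dx`, the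
measure for which the proposal is reversible. The acceptance probability is then `min(1,
w(y)/w(x))`, and the Lyapunov function is `V = w^{-1/2}`. Conditionally on a proposal with ratio `t
= w(y)/w(x)`, the mean of `V(X₁)/V(X₀)` is `φ(t) = min(1,t)/√t + 1 - min(1,t)` (`mhRate`). Since the
proposal commutes with dilations, `PV(x)/V(x)` is the integral of `φ(w(‖x‖z)/w(x))` against the
proposal density from the unit vector `x/‖x‖` (`lintegral_mpcnLyapunov`). It never exceeds `5/4`, so
only its behaviour near the origin and near infinity matters.

Regular variation: if `w(‖x‖z)/w(x) → ‖z‖^β` with `β ≠ 0`, the limiting ratio is the integral of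
`φ(‖z‖^β)`. The proposal from a unit vector is invariant under `z ↦ z/‖z‖²`, which turns `t = ‖z‖^β`
into `1/t`; averaging the two forms and using `φ(t) + φ(1/t) = 2 - (1 - √min(t,1/t))²` gives a value
below `1`, uniformly in the direction (`exists_driftRatio_le_of_tendsto_rpow`). This covers the
origin for every continuous positive `p`, with `β = d`, and infinity for the heavy-tailed class,
with `β = d - α`.

Rapid variation: the ratio `t` is typically near `0`, where `φ` is near `1`, or very large, where
`φ` is small; intermediate values have vanishing mass (`tendsto_integral_ratioWindow`). The
curvature condition supplies a ball of proposals of fixed size on which `t` is bounded below, hence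
typically large, and this gives a strict gain (`exists_driftRatio_le_of_rapidlyVarying`).

In both classes integrability of `p` forces `w → 0` at infinity (`tendsto_radialWeight_cobounded`),
and `w → 0` at the origin. Sublevel sets of `V` away from `0` thus lie in annuli, where the kernel
dominates a multiple of Lebesgue measure. Drift and minorization on the absorbing set `x ≠ 0` then
give the result by the Harris theorem, proved by contraction of a weighted oscillation. -/

theorem integrable_of_lintegral_ofReal_ne_top {μ : Measure E} {V : E → ℝ} (hV : Measurable V)
    (hV0 : ∀ x, 0 ≤ V x) (h : ∫⁻ x, ENNReal.ofReal (V x) ∂μ ≠ ∞) : Integrable V μ := by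
  refine ⟨hV.aestronglyMeasurable, ?_⟩
  rw [hasFiniteIntegral_iff_ofReal (ae_of_all _ hV0)]
  exact h.lt_top

theorem integral_le_of_lintegral_ofReal_le {μ : Measure E} {V : E → ℝ} (hV : Measurable V)
    (hV0 : ∀ x, 0 ≤ V x) {a : ℝ} (ha : 0 ≤ a)
    (h : ∫⁻ x, ENNReal.ofReal (V x) ∂μ ≤ ENNReal.ofReal a) : ∫ x, V x ∂μ ≤ a := by
  rw [integral_eq_lintegral_of_nonneg_ae (ae_of_all _ hV0) hV.aestronglyMeasurable]
  exact ENNReal.toReal_le_of_le_ofReal ha h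

/-- A function that is within weighted distance `C (1 + β V)` of a constant is integrable as soon as
`V` is. -/
theorem integrable_of_abs_sub_le {μ : Measure E} [IsFiniteMeasure μ] {S : Set E} (hS : μ Sᶜ = 0)
    {V f : E → ℝ} (hVi : Integrable V μ) (hf : Measurable f) {C β c : ℝ}
    (h : ∀ x ∈ S, |f x - c| ≤ C * (1 + β * V x)) : Integrable f μ := by
  have h1 : Integrable (fun x => C * (1 + β * V x) + |c|) μ :=
    (((integrable_const 1).add (hVi.const_mul β)).const_mul C).add (integrable_const _)
  refine h1.mono' hf.aestronglyMeasurable ?_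
  filter_upwards [compl_mem_ae_iff.mpr hS] with x hx
  have h2 := h x (by simpa using hx)
  have h3 : |f x| ≤ |f x - c| + |c| := by
    simpa using abs_add_le (f x - c) c
  rw [Real.norm_eq_abs]
  linarith

/-- A function with weighted oscillation at most `C` is within weighted distance `C` of some
constant. -/
theorem exists_center {E : Type*} {S : Set E} (hne : S.Nonempty) {V g : E → ℝ} {C β : ℝ}
    (h : ∀ x ∈ S, ∀ y ∈ S, |g x - g y| ≤ C * (2 + β * V x + β * V y)) :
    ∃ c, ∀ x ∈ S, |g x - c| ≤ C * (1 + β * V x) := by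
  -- Every value of the lower envelope `g - C(1+βV)` lies below every value of the upper envelope `g
  -- + C(1+βV)`; the supremum of the lower one separates them and serves as the center.
  have key : ∀ x ∈ S, ∀ y ∈ S, g x - C * (1 + β * V x) ≤ g y + C * (1 + β * V y) := by
    intro x hx y hy
    have := (abs_le.mp (h x hx y hy)).2
    nlinarith
  obtain ⟨y0, hy0⟩ := hne
  have hbdd : BddAbove ((fun x => g x - C * (1 + β * V x)) '' S) := by
    refine ⟨g y0 + C * (1 + β * V y0), ?_⟩
    rintro _ ⟨x, hx, rfl⟩
    exact key x hx y0 hy0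
  refine ⟨sSup ((fun x => g x - C * (1 + β * V x)) '' S), fun x hx => ?_⟩
  rw [abs_le]
  constructor
  · have : sSup ((fun x => g x - C * (1 + β * V x)) '' S) ≤ g x + C * (1 + β * V x) := by
      refine csSup_le ⟨_, y0, hy0, rfl⟩ ?_
      rintro _ ⟨y, hy, rfl⟩
      exact key y hy x hx
    linarith
  · have := le_csSup hbdd ⟨x, hx, rfl⟩
    simp only at this
    linarith

/-- An invariant probability measure integrates a function satisfying a drift inequality. -/
theorem lintegral_le_of_invariant_of_drift {P : Kernel E E} [IsMarkovKernel P] {Pi : Measure E}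
    [IsProbabilityMeasure Pi] (hinv : P.Invariant Pi) {S : Set E} (hPiS : Pi Sᶜ = 0)
    {V : E → ℝ} (hV : Measurable V) (hV0 : ∀ x, 0 ≤ V x) {l b : ℝ} (hl0 : 0 ≤ l) (hl1 : l < 1)
    (hb : 0 ≤ b)
    (hdrift : ∀ x ∈ S, ∫⁻ y, ENNReal.ofReal (V y) ∂(P x) ≤ ENNReal.ofReal (l * V x + b)) :
    ∫⁻ x, ENNReal.ofReal (V x) ∂Pi ≤ ENNReal.ofReal (b / (1 - l)) := by
  have hl : 0 < 1 - l := by linarith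
  -- The integral of `V` is not yet known to be finite, so it cannot be cancelled in `Pi V ≤ l Pi V
  -- + b`. Truncating at `n` makes the cancelled term finite; monotone convergence removes the
  -- truncation.
  have step : ∀ n : ℕ, ∫⁻ x, ENNReal.ofReal ((1 - l) * (if V x ≤ n then V x else 0)) ∂Pi
      ≤ ENNReal.ofReal b := by
    intro n
    have hn : (0 : ℝ) ≤ n := n.cast_nonneg
    have hmVn : Measurable fun x => ENNReal.ofReal (min (V x) n) := by fun_prop
    have e1 : ∫⁻ x, ENNReal.ofReal (min (V x) n) ∂Pi
        ≤ ∫⁻ x, ENNReal.ofReal (min (l * V x + b) n) ∂Pi := by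
      conv_lhs => rw [← hinv.def]
      rw [Measure.lintegral_bind (Kernel.aemeasurable _) hmVn.aemeasurable]
      refine lintegral_mono_ae ?_
      filter_upwards [compl_mem_ae_iff.mpr hPiS] with x hx
      have hx : x ∈ S := by simpa using hx
      rw [ENNReal.ofReal_min]
      refine le_min ?_ ?_
      · exact (lintegral_mono fun y => ENNReal.ofReal_le_ofReal (min_le_left _ _)).trans (hdrift x hx)
      · calc ∫⁻ y, ENNReal.ofReal (min (V y) n) ∂(P x)
            ≤ ∫⁻ _, ENNReal.ofReal n ∂(P x) :=
              lintegral_mono fun y => ENNReal.ofReal_le_ofReal (min_le_right _ _)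
          _ = ENNReal.ofReal n := by simp
    have hfin : ∫⁻ x, ENNReal.ofReal (min (l * V x + b) n) ∂Pi ≠ ∞ := by
      refine ne_top_of_le_ne_top (b := ENNReal.ofReal n) ENNReal.ofReal_ne_top ?_
      calc _ ≤ ∫⁻ _, ENNReal.ofReal n ∂Pi :=
              lintegral_mono fun y => ENNReal.ofReal_le_ofReal (min_le_right _ _)
        _ = _ := by simp
    have hmi : Measurable fun x => ENNReal.ofReal ((1 - l) * (if V x ≤ n then V x else 0)) := by
      have : Measurable fun x => if V x ≤ n then V x else 0 :=
        Measurable.ite (measurableSet_le hV measurable_const) hV measurable_const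
      fun_prop
    have e2 : ∫⁻ x, ENNReal.ofReal (min (l * V x + b) n) ∂Pi
          + ∫⁻ x, ENNReal.ofReal ((1 - l) * (if V x ≤ n then V x else 0)) ∂Pi
        ≤ ∫⁻ x, ENNReal.ofReal (min (l * V x + b) n) ∂Pi + ENNReal.ofReal b := by
      calc _ = ∫⁻ x, (ENNReal.ofReal (min (l * V x + b) n)
                + ENNReal.ofReal ((1 - l) * (if V x ≤ n then V x else 0))) ∂Pi :=
              (lintegral_add_right _ hmi).symm
        _ ≤ ∫⁻ x, (ENNReal.ofReal (min (V x) n) + ENNReal.ofReal b) ∂Pi := by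
            refine lintegral_mono fun x => ?_
            have hx := hV0 x
            have h0 : 0 ≤ (1 - l) * (if V x ≤ n then V x else 0) := by
              split_ifs <;> positivity
            have h1 : 0 ≤ min (l * V x + b) (n : ℝ) := le_min (by positivity) hn
            have h2 : 0 ≤ min (V x) (n : ℝ) := le_min hx hn
            simp only
            rw [← ENNReal.ofReal_add h1 h0, ← ENNReal.ofReal_add h2 hb]
            refine ENNReal.ofReal_le_ofReal ?_
            split_ifs with h
            · rw [min_eq_left h]
              have := min_le_left (l * V x + b) (n : ℝ)
              linarith
            · rw [min_eq_right (not_le.mp h).le]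
              have := min_le_right (l * V x + b) (n : ℝ)
              linarith
        _ = ∫⁻ x, ENNReal.ofReal (min (V x) n) ∂Pi + ENNReal.ofReal b := by
            rw [lintegral_add_right _ measurable_const]; simp
        _ ≤ _ := by gcongr
    exact (ENNReal.add_le_add_iff_left hfin).mp e2
  have hlim : ∫⁻ x, ENNReal.ofReal ((1 - l) * V x) ∂Pi ≤ ENNReal.ofReal b := by
    have hmono : Monotone fun (n : ℕ) x =>
        ENNReal.ofReal ((1 - l) * (if V x ≤ (n : ℝ) then V x else 0)) := by
      intro n m hnm x
      refine ENNReal.ofReal_le_ofReal (mul_le_mul_of_nonneg_left ?_ hl.le)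
      have hnm' : (n : ℝ) ≤ m := by exact_mod_cast hnm
      have := hV0 x
      split_ifs <;> linarith
    have hmeas : ∀ n : ℕ, Measurable fun x =>
        ENNReal.ofReal ((1 - l) * (if V x ≤ (n : ℝ) then V x else 0)) := by
      intro n
      have : Measurable fun x => if V x ≤ (n : ℝ) then V x else 0 :=
        Measurable.ite (measurableSet_le hV measurable_const) hV measurable_const
      fun_prop
    have hsup : ∀ x, ENNReal.ofReal ((1 - l) * V x)
        ≤ ⨆ n : ℕ, ENNReal.ofReal ((1 - l) * (if V x ≤ (n : ℝ) then V x else 0)) := by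
      intro x
      obtain ⟨n, hn⟩ := exists_nat_ge (V x)
      refine le_iSup_of_le n ?_
      rw [if_pos hn]
    refine (lintegral_mono hsup).trans ?_
    rw [lintegral_iSup hmeas hmono]
    exact iSup_le step
  have h2 : ENNReal.ofReal (1 - l) * ∫⁻ x, ENNReal.ofReal (V x) ∂Pi ≤ ENNReal.ofReal b := by
    rw [← lintegral_const_mul _ (by fun_prop)]
    simpa only [ENNReal.ofReal_mul hl.le] using hlim
  rw [ENNReal.ofReal_div_of_pos hl, ENNReal.le_div_iff_mul_le
    (Or.inl (by simpa using hl)) (Or.inl ENNReal.ofReal_ne_top), mul_comm]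
  exact h2

variable {P : Kernel E E} [IsMarkovKernel P] {S : Set E} {V : E → ℝ} {l b : ℝ}

/-- Bound for the mean of a centered function. -/
theorem abs_integral_sub_le {μ : Measure E} [IsProbabilityMeasure μ] (hS : μ Sᶜ = 0)
    (hVi : Integrable V μ) {f : E → ℝ} (hf : Measurable f) {C β c : ℝ}
    (h : ∀ x ∈ S, |f x - c| ≤ C * (1 + β * V x)) :
    |∫ x, f x ∂μ - c| ≤ C * (1 + β * ∫ x, V x ∂μ) := by
  have hfi := integrable_of_abs_sub_le hS hVi hf h
  have e1 : ∫ x, f x ∂μ - c = ∫ x, (f x - c) ∂μ := by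
    rw [integral_sub hfi (integrable_const _)]; simp
  have e2 : C * (1 + β * ∫ x, V x ∂μ) = ∫ x, C * (1 + β * V x) ∂μ := by
    rw [integral_const_mul, integral_add (integrable_const _) (hVi.const_mul β),
      integral_const_mul]
    simp
  rw [e1, e2]
  refine (abs_integral_le_integral_abs).trans ?_
  refine integral_mono_ae (hfi.sub (integrable_const c)).abs
    (((integrable_const 1).add (hVi.const_mul β)).const_mul C) ?_
  filter_upwards [compl_mem_ae_iff.mpr hS] with x hx
  exact h x (by simpa using hx)

/-- Improved bound for the mean of a centered function after removal of a common component `ν`. -/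
theorem abs_integral_sub_integral_le {μ ν : Measure E} [IsProbabilityMeasure μ] (hνμ : ν ≤ μ)
    (hS : μ Sᶜ = 0) (hV0 : ∀ x, 0 ≤ V x)
    (hVi : Integrable V μ) {f : E → ℝ} (hf : Measurable f) {C β c : ℝ} (hC : 0 ≤ C) (hβ : 0 ≤ β)
    (h : ∀ x ∈ S, |f x - c| ≤ C * (1 + β * V x)) :
    |∫ x, f x ∂μ - c - ∫ x, (f x - c) ∂ν| ≤ C * (1 - ν.real Set.univ + β * ∫ x, V x ∂μ) := by
  have : IsFiniteMeasure ν := isFiniteMeasure_of_le μ hνμ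
  have hfi := integrable_of_abs_sub_le hS hVi hf h
  have hgi : Integrable (fun x => f x - c) μ := hfi.sub (integrable_const c)
  have hWi : Integrable (fun x => C * (1 + β * V x)) μ :=
    ((integrable_const 1).add (hVi.const_mul β)).const_mul C
  have hgiν := hgi.mono_measure hνμ
  have hWiν := hWi.mono_measure hνμ
  have hae : ∀ᵐ x ∂μ, |f x - c| ≤ C * (1 + β * V x) := by
    filter_upwards [compl_mem_ae_iff.mpr hS] with x hx
    exact h x (by simpa using hx)
  have e1 : ∫ x, f x ∂μ - c = ∫ x, (f x - c) ∂μ := by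
    rw [integral_sub hfi (integrable_const _)]; simp
  have e2 : ∫ x, C * (1 + β * V x) ∂μ = C * (1 + β * ∫ x, V x ∂μ) := by
    rw [integral_const_mul, integral_add (integrable_const _) (hVi.const_mul β),
      integral_const_mul]
    simp
  have e3 : C * ν.real Set.univ ≤ ∫ x, C * (1 + β * V x) ∂ν := by
    have : C * ν.real Set.univ = ∫ _, C ∂ν := by simp [mul_comm]
    rw [this]
    refine integral_mono (integrable_const _) hWiν fun x => ?_
    have := mul_nonneg hC (mul_nonneg hβ (hV0 x))
    simp only
    linarith
  -- Both `C(1+βV) - (f-c)` and `C(1+βV) + (f-c)` are nonnegative, so their integrals increase from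
  -- `ν` to `μ`; these are the two sides of the absolute value.
  have h1 : ∫ x, (C * (1 + β * V x) - (f x - c)) ∂ν ≤ ∫ x, (C * (1 + β * V x) - (f x - c)) ∂μ := by
    refine integral_mono_measure hνμ ?_ (hWi.sub hgi)
    filter_upwards [hae] with x hx
    have := (abs_le.mp hx).2
    simp only [Pi.zero_apply]
    linarith
  have h2 : ∫ x, (C * (1 + β * V x) + (f x - c)) ∂ν ≤ ∫ x, (C * (1 + β * V x) + (f x - c)) ∂μ := by
    refine integral_mono_measure hνμ ?_ (hWi.add hgi)
    filter_upwards [hae] with x hx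
    have := (abs_le.mp hx).1
    simp only [Pi.zero_apply]
    linarith
  rw [integral_sub hWiν hgiν, integral_sub hWi hgi] at h1
  rw [integral_add hWiν hgiν, integral_add hWi hgi] at h2
  rw [e1, abs_le]
  constructor <;> nlinarith

/-- One step of a kernel with drift and minorization contracts the weighted oscillation. -/
theorem exists_contraction (hSP : ∀ x ∈ S, P x Sᶜ = 0) (hne : S.Nonempty)
    (hV : Measurable V) (hV0 : ∀ x, 0 ≤ V x) (hl0 : 0 ≤ l) (hl1 : l < 1) (hb : 0 < b)
    (hdrift : ∀ x ∈ S, ∫⁻ y, ENNReal.ofReal (V y) ∂(P x) ≤ ENNReal.ofReal (l * V x + b))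
    (hminor : ∀ R : ℝ, ∃ ν : Measure E, ν ≠ 0 ∧ ∀ x ∈ S, V x ≤ R → ν ≤ P x) :
    ∃ β γ : ℝ, 0 < β ∧ 0 < γ ∧ γ < 1 ∧ ∀ (f : E → ℝ) (C : ℝ), Measurable f → 0 ≤ C →
      (∃ c, ∀ x ∈ S, |f x - c| ≤ C * (1 + β * V x)) →
      ∃ c, ∀ x ∈ S, |∫ y, f y ∂(P x) - c| ≤ (C * γ) * (1 + β * V x) := by
  have hl : 0 < 1 - l := by linarith
  -- With `(1-l)R = 4b`, once `V x + V y > R` half of the drift gain absorbs the two additive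
  -- constants `b`.
  obtain ⟨R, hR⟩ : ∃ R, R = 4 * b / (1 - l) := ⟨_, rfl⟩
  have hR0 : 0 < R := by rw [hR]; positivity
  have hRb : (1 - l) * R = 4 * b := by rw [hR]; field_simp
  have hVi : ∀ x ∈ S, Integrable V (P x) := fun x hx =>
    integrable_of_lintegral_ofReal_ne_top hV hV0
      (ne_top_of_le_ne_top ENNReal.ofReal_ne_top (hdrift x hx))
  have hVle : ∀ x ∈ S, ∫ y, V y ∂(P x) ≤ l * V x + b := fun x hx =>
    integral_le_of_lintegral_ofReal_le hV hV0
      (add_nonneg (mul_nonneg hl0 (hV0 x)) hb.le) (hdrift x hx)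
  obtain ⟨ν, hν0, hν⟩ := hminor R
  -- The cap at `1` ensures `1 - ε/2 > 0`, hence a positive contraction rate.
  obtain ⟨ε, hε⟩ : ∃ ε, ε = min (ν.real Set.univ) 1 := ⟨_, rfl⟩
  by_cases hsmall : ∃ x ∈ S, V x ≤ R
  swap
  · -- no state has small `V`: the drift alone contracts
    push Not at hsmall
    refine ⟨1, 1 - (1 - l) * R / (2 * (2 + R)), one_pos, ?_, ?_, ?_⟩
    · rw [sub_pos, div_lt_one (by positivity)]; nlinarith
    · have : 0 < (1 - l) * R / (2 * (2 + R)) := by positivity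
      linarith
    · rintro f C hf hC ⟨c, hc⟩
      refine ⟨c, fun x hx => ?_⟩
      refine (abs_integral_sub_le (hSP x hx) (hVi x hx) hf hc).trans ?_
      rw [mul_assoc]
      refine mul_le_mul_of_nonneg_left ?_ hC
      have h1 := hVle x hx
      have h2 := hsmall x hx
      have h3 : (1 - l) * R / (2 * (2 + R)) * (1 + V x) ≤ (1 - l) * V x / 2 := by
        rw [div_mul_eq_mul_div, div_le_div_iff₀ (by positivity) (by positivity)]
        have : R * (1 + V x) ≤ V x * (2 + R) := by nlinarith
        nlinarith [mul_le_mul_of_nonneg_left this hl.le]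
      nlinarith
  obtain ⟨x0, hx0, hVx0⟩ := hsmall
  have hνfin : IsFiniteMeasure ν := isFiniteMeasure_of_le (P x0) (hν x0 hx0 hVx0)
  have hνpos : 0 < ν.real Set.univ := by
    rw [Measure.real, ENNReal.toReal_pos_iff]
    exact ⟨by simpa [pos_iff_ne_zero] using hν0, measure_lt_top _ _⟩
  have hε0 : 0 < ε := by rw [hε]; exact lt_min hνpos one_pos
  have hε1 : ε ≤ 1 := by rw [hε]; exact min_le_right _ _
  have hεν : ε ≤ ν.real Set.univ := by rw [hε]; exact min_le_left _ _
  -- Chosen so that `2βb = ε`: on the small set the common component saves `2ε` and the drift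
  -- constants cost only `ε`, leaving `2(1 - ε/2)`.
  obtain ⟨β, hβ⟩ : ∃ β, β = ε / (2 * b) := ⟨_, rfl⟩
  have hβ0 : 0 < β := by rw [hβ]; positivity
  have hβb : β * b = ε / 2 := by rw [hβ]; field_simp
  obtain ⟨κ, hκ⟩ : ∃ κ, κ = (1 - l) * (β * R) / (2 * (2 + β * R)) := ⟨_, rfl⟩
  have hκ0 : 0 < κ := by rw [hκ]; positivity
  obtain ⟨γ, hγ⟩ : ∃ γ, γ = max (max (1 - κ) (1 - ε / 2)) l := ⟨_, rfl⟩
  have hγκ : 1 - κ ≤ γ := by rw [hγ]; exact (le_max_left _ _).trans (le_max_left _ _)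
  have hγε : 1 - ε / 2 ≤ γ := by rw [hγ]; exact (le_max_right _ _).trans (le_max_left _ _)
  have hγl : l ≤ γ := by rw [hγ]; exact le_max_right _ _
  have hγ1 : γ < 1 := by
    rw [hγ]; exact max_lt (max_lt (by linarith) (by linarith)) hl1
  have hγ0 : 0 < γ := by linarith
  refine ⟨β, γ, hβ0, hγ0, hγ1, ?_⟩
  rintro f C hf hC ⟨c, hc⟩
  refine exists_center hne fun x hx y hy => ?_
  have hPx := hVle x hx
  have hPy := hVle y hy
  rw [mul_assoc]
  have hVx := hV0 x
  have hVy := hV0 y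
  by_cases hs : V x + V y ≤ R
  · -- both states are in the small set
    have hx' := abs_integral_sub_integral_le (hν x hx (by linarith)) (hSP x hx) hV0 (hVi x hx) hf
      hC hβ0.le hc
    have hy' := abs_integral_sub_integral_le (hν y hy (by linarith)) (hSP y hy) hV0 (hVi y hy) hf
      hC hβ0.le hc
    -- The integral of `f - c` over the common component `ν` is the same for both starting points
    -- and cancels in the difference.
    have e : ∫ z, f z ∂(P x) - ∫ z, f z ∂(P y) =
        (∫ z, f z ∂(P x) - c - ∫ z, (f z - c) ∂ν) - (∫ z, f z ∂(P y) - c - ∫ z, (f z - c) ∂ν) := by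
      ring
    rw [e]
    refine (abs_sub _ _).trans ((add_le_add hx' hy').trans ?_)
    rw [← mul_add]
    refine mul_le_mul_of_nonneg_left ?_ hC
    have h1 : β * ∫ z, V z ∂(P x) ≤ β * (l * V x + b) := mul_le_mul_of_nonneg_left hPx hβ0.le
    have h2 : β * ∫ z, V z ∂(P y) ≤ β * (l * V y + b) := mul_le_mul_of_nonneg_left hPy hβ0.le
    have h3 : l * (β * V x + β * V y) ≤ γ * (β * V x + β * V y) :=
      mul_le_mul_of_nonneg_right hγl (by positivity)
    nlinarith
  · push Not at hs
    have hx' := abs_integral_sub_le (hSP x hx) (hVi x hx) hf hc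
    have hy' := abs_integral_sub_le (hSP y hy) (hVi y hy) hf hc
    have e : ∫ z, f z ∂(P x) - ∫ z, f z ∂(P y) =
        (∫ z, f z ∂(P x) - c) - (∫ z, f z ∂(P y) - c) := by ring
    rw [e]
    refine (abs_sub _ _).trans ((add_le_add hx' hy').trans ?_)
    rw [← mul_add]
    refine mul_le_mul_of_nonneg_left ?_ hC
    have h1 : β * ∫ z, V z ∂(P x) ≤ β * (l * V x + b) := mul_le_mul_of_nonneg_left hPx hβ0.le
    have h2 : β * ∫ z, V z ∂(P y) ≤ β * (l * V y + b) := mul_le_mul_of_nonneg_left hPy hβ0.le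
    obtain ⟨s, hs'⟩ : ∃ s, s = V x + V y := ⟨_, rfl⟩
    have h3 : κ * (2 + β * s) ≤ (1 - l) * (β * s) / 2 := by
      rw [hκ, div_mul_eq_mul_div, div_le_div_iff₀ (by positivity) (by positivity)]
      have h4 : β * R ≤ β * s := mul_le_mul_of_nonneg_left (by linarith) hβ0.le
      have : (β * R) * (2 + β * s) ≤ β * s * (2 + β * R) := by nlinarith
      nlinarith [mul_le_mul_of_nonneg_left this hl.le]
    have h5 : 2 * (β * b) ≤ (1 - l) * (β * s) / 2 := by
      have : (1 - l) * R ≤ (1 - l) * s := mul_le_mul_of_nonneg_left (by linarith) hl.le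
      have := mul_le_mul_of_nonneg_left this hβ0.le
      nlinarith
    have h6 : (1 - κ) * (2 + β * s) ≤ γ * (2 + β * s) :=
      mul_le_mul_of_nonneg_right hγκ (by rw [hs']; positivity)
    rw [hs'] at h3 h5 h6
    linarith

/-- **Harris theorem** in the form of Hairer and Mattingly: a Markov kernel that satisfies a
drift condition and minorizes on the sublevel sets of the Lyapunov function, both on an absorbing
set of full measure, is geometrically ergodic. -/
theorem geometricallyErgodic_of_drift_of_minorization {Pi : Measure E} [IsProbabilityMeasure Pi]
    (hinv : P.Invariant Pi) (hSm : MeasurableSet S) (hSP : ∀ x ∈ S, P x Sᶜ = 0) (hPiS : Pi Sᶜ = 0)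
    (hV : Measurable V) (hV0 : ∀ x, 0 ≤ V x) (hl0 : 0 ≤ l) (hl1 : l < 1) (hb : 0 < b)
    (hdrift : ∀ x ∈ S, ∫⁻ y, ENNReal.ofReal (V y) ∂(P x) ≤ ENNReal.ofReal (l * V x + b))
    (hminor : ∀ R : ℝ, ∃ ν : Measure E, ν ≠ 0 ∧ ∀ x ∈ S, V x ≤ R → ν ≤ P x) :
    GeometricallyErgodic P Pi := by
  classical
  have hne : S.Nonempty := by
    rw [Set.nonempty_iff_ne_empty]
    rintro rfl
    simp at hPiS
  obtain ⟨β, γ, hβ, hγ0, hγ1, hcontr⟩ :=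
    exists_contraction hSP hne hV hV0 hl0 hl1 hb hdrift hminor
  have hPiV := lintegral_le_of_invariant_of_drift hinv hPiS hV hV0 hl0 hl1 hb.le hdrift
  have hPiVi : Integrable V Pi := integrable_of_lintegral_ofReal_ne_top hV hV0
    (ne_top_of_le_ne_top ENNReal.ofReal_ne_top hPiV)
  have hPiV0 : 0 ≤ ∫ x, V x ∂Pi := integral_nonneg hV0
  have hmarkov : ∀ n : ℕ, IsMarkovKernel (P ^ n) := by
    intro n
    induction n with
    | zero => rw [pow_zero]; exact inferInstanceAs (IsMarkovKernel Kernel.id)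
    | succ n ih => rw [pow_succ']; exact inferInstanceAs (IsMarkovKernel (P ∘ₖ (P ^ n)))
  have hpow : ∀ (n : ℕ), ∀ x ∈ S, (P ^ n) x Sᶜ = 0 ∧ Integrable V ((P ^ n) x) := by
    intro n x hx
    suffices h : (P ^ n) x Sᶜ = 0 ∧ ∫⁻ y, ENNReal.ofReal (V y) ∂((P ^ n) x) ≠ ∞ from
      ⟨h.1, integrable_of_lintegral_ofReal_ne_top hV hV0 h.2⟩
    induction n with
    | zero =>
      rw [pow_zero]
      change Kernel.id x Sᶜ = 0 ∧ ∫⁻ y, ENNReal.ofReal (V y) ∂(Kernel.id x) ≠ ∞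
      rw [Kernel.id_apply, lintegral_dirac' _ (by fun_prop), Measure.dirac_apply' _ hSm.compl]
      exact ⟨by simpa using hx, ENNReal.ofReal_ne_top⟩
    | succ n ih =>
      have hae : ∀ᵐ y ∂((P ^ n) x), y ∈ S := by
        filter_upwards [compl_mem_ae_iff.mpr ih.1] with y hy
        simpa using hy
      rw [pow_succ']
      change (P ∘ₖ (P ^ n)) x Sᶜ = 0 ∧ ∫⁻ y, ENNReal.ofReal (V y) ∂((P ∘ₖ (P ^ n)) x) ≠ ∞
      rw [Kernel.comp_apply' _ _ _ hSm.compl, Kernel.lintegral_comp _ _ _ (by fun_prop)]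
      constructor
      · rw [lintegral_eq_zero_iff (Kernel.measurable_coe _ hSm.compl)]
        filter_upwards [hae] with y hy
        exact hSP y hy
      · have := hmarkov n
        refine ne_top_of_le_ne_top ?_ (lintegral_mono_ae (hae.mono fun y hy =>
          (hdrift y hy).trans (ENNReal.ofReal_add_le)))
        rw [lintegral_add_right _ measurable_const]
        simp only [ENNReal.ofReal_mul hl0, lintegral_const, measure_univ, mul_one]
        rw [lintegral_const_mul _ (by fun_prop)]
        exact ENNReal.add_ne_top.mpr ⟨ENNReal.mul_ne_top ENNReal.ofReal_ne_top ih.2,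
          ENNReal.ofReal_ne_top⟩
  -- The induction runs over all `f` and `C` at once: the step replaces `f` by `Pf` and `C` by `Cγ`,
  -- while the means under `Pi` agree by invariance.
  have key : ∀ (n : ℕ) (f : E → ℝ) (C : ℝ), Measurable f → 0 ≤ C →
      (∃ c, ∀ x ∈ S, |f x - c| ≤ C * (1 + β * V x)) → ∀ x ∈ S,
      |∫ y, f y ∂((P ^ n) x) - ∫ y, f y ∂Pi| ≤
        C * γ ^ n * (2 + β * V x + β * ∫ y, V y ∂Pi) := by
    intro n
    induction n with
    | zero =>
      rintro f C hf hC ⟨c, hc⟩ x hx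
      have h1 := abs_integral_sub_le hPiS hPiVi hf hc
      have h2 := hc x hx
      have e : ∫ y, f y ∂((P ^ 0) x) = f x := by
        rw [pow_zero]
        change ∫ y, f y ∂(Kernel.id x) = f x
        rw [Kernel.id_apply, integral_dirac' _ _ hf.stronglyMeasurable]
      rw [e]
      have e2 : f x - ∫ y, f y ∂Pi = (f x - c) - (∫ y, f y ∂Pi - c) := by ring
      rw [e2]
      refine (abs_sub _ _).trans ((add_le_add h2 h1).trans (le_of_eq ?_))
      rw [pow_zero]; ring
    | succ n ih =>
      rintro f C hf hC ⟨c, hc⟩ x hx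
      have := hmarkov n
      have := hmarkov (n + 1)
      have hPf : Measurable fun y => ∫ z, f z ∂(P y) :=
        (hf.stronglyMeasurable.integral_kernel (κ := P)).measurable
      have h1 := ih (fun y => ∫ z, f z ∂(P y)) (C * γ) hPf (by positivity)
        (hcontr f C hf hC ⟨c, hc⟩) x hx
      have i1 : Integrable f ((P ^ (n + 1)) x) :=
        integrable_of_abs_sub_le (hpow (n + 1) x hx).1 (hpow (n + 1) x hx).2 hf hc
      have e1 : ∫ y, f y ∂((P ^ (n + 1)) x) = ∫ y, ∫ z, f z ∂(P y) ∂((P ^ n) x) := by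
        rw [pow_succ'] at i1 ⊢
        exact Kernel.integral_comp i1
      have i2 : Integrable f Pi := integrable_of_abs_sub_le hPiS hPiVi hf hc
      have e2 : ∫ y, f y ∂Pi = ∫ y, ∫ z, f z ∂(P y) ∂Pi := by
        conv_lhs => rw [← hinv.def]
        rw [← hinv.def] at i2
        rw [Measure.comp_eq_comp_const_apply] at i2 ⊢
        simpa using Kernel.integral_comp i2
      rw [e1, e2]
      refine h1.trans (le_of_eq ?_)
      rw [pow_succ]; ring
  -- Setting the weight to `∞` off `S` makes the bound there vacuous, and costs nothing almost
  -- surely since `Pi Sᶜ = 0`.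
  refine ⟨fun x => if x ∈ S then ENNReal.ofReal (1 + β * V x) else ∞, ?_, ?_, ?_, γ,
    2 + β * ∫ y, V y ∂Pi, hγ0, hγ1, by positivity, ?_⟩
  · exact Measurable.ite hSm (by fun_prop) measurable_const
  · intro x
    dsimp only
    split_ifs
    · rw [ENNReal.one_le_ofReal]
      have := mul_nonneg hβ.le (hV0 x)
      linarith
    · exact le_top
  · filter_upwards [compl_mem_ae_iff.mpr hPiS] with x hx
    rw [if_pos (by simpa using hx)]
    exact ENNReal.ofReal_lt_top
  · intro n x
    have hc0 : 0 < (2 + β * ∫ y, V y ∂Pi) * γ ^ n := by positivity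
    by_cases hx : x ∈ S
    swap
    · simp only [if_neg hx]
      rw [ENNReal.mul_top (by simpa using hc0)]
      exact le_top
    · simp only [if_pos hx]
      unfold vNormDist
      refine iSup_le fun f => iSup_le fun hf => iSup_le fun hfV => iSup_le fun _ => iSup_le fun _ => ?_
      rw [← ENNReal.ofReal_mul hc0.le]
      refine ENNReal.ofReal_le_ofReal ?_
      have h1 := key n f 1 hf zero_le_one ⟨0, fun y hy => by
        have := hfV y
        simp only [if_pos hy] at this
        rw [ENNReal.ofReal_le_ofReal_iff
          (by have := mul_nonneg hβ.le (hV0 y); linarith)] at this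
        simpa using this⟩ x hx
      refine h1.trans ?_
      have h2 : 0 < γ ^ n := by positivity
      have h3 := mul_nonneg hβ.le (hV0 x)
      have h4 := mul_nonneg hβ.le hPiV0
      have h5 : 2 + β * V x + β * ∫ y, V y ∂Pi ≤ (2 + β * ∫ y, V y ∂Pi) * (1 + β * V x) := by
        nlinarith [mul_nonneg h3 h4]
      calc _ = γ ^ n * (2 + β * V x + β * ∫ y, V y ∂Pi) := by ring
        _ ≤ γ ^ n * ((2 + β * ∫ y, V y ∂Pi) * (1 + β * V x)) :=
            mul_le_mul_of_nonneg_left h5 h2.le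
        _ = _ := by ring

end Harris

/-! ### General facts on Metropolis–Hastings kernels -/

section MetropolisHastingsFacts

variable {E : Type*} [MeasurableSpace E] {Q : Kernel E E} [IsMarkovKernel Q] {p p' : E → ℝ}
  {hp : Measurable p} {hp' : Measurable p'}

theorem acceptProb_le_one {E : Type*} (p p' : E → ℝ) (x y : E) : acceptProb p p' x y ≤ 1 := by
  unfold acceptProb
  exact ENNReal.ofReal_le_one.mpr (min_le_left _ _)

theorem lintegral_acceptProb_le_one (p p' : E → ℝ) (x : E) :
    ∫⁻ z, acceptProb p p' x z ∂(Q x) ≤ 1 :=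
  (lintegral_mono fun z => acceptProb_le_one p p' x z).trans (by simp)

theorem mhKernel_apply (x : E) :
    mhKernel Q p p' hp hp' x = (Q x).withDensity (acceptProb p p' x) +
      (1 - ∫⁻ z, acceptProb p p' x z ∂(Q x)) • Measure.dirac x := rfl

theorem measurable_acceptProb_right (hp : Measurable p) (hp' : Measurable p') (x : E) :
    Measurable (acceptProb p p' x) :=
  (measurable_acceptProb hp hp').comp measurable_prodMk_left

instance isMarkovKernel_mhKernel : IsMarkovKernel (mhKernel Q p p' hp hp') := by
  refine ⟨fun x => ⟨?_⟩⟩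
  rw [mhKernel_apply, Measure.add_apply, Measure.smul_apply, withDensity_apply _ MeasurableSet.univ,
    Measure.restrict_univ, measure_univ, smul_eq_mul, mul_one]
  exact add_tsub_cancel_of_le (lintegral_acceptProb_le_one p p' x)

theorem lintegral_mhKernel {F : E → ℝ≥0∞} (hF : Measurable F) (x : E) :
    ∫⁻ y, F y ∂(mhKernel Q p p' hp hp' x) =
      ∫⁻ y, acceptProb p p' x y * F y ∂(Q x) +
        (1 - ∫⁻ z, acceptProb p p' x z ∂(Q x)) * F x := by
  rw [mhKernel_apply, lintegral_add_measure, lintegral_smul_measure, lintegral_dirac' _ hF,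
    lintegral_withDensity_eq_lintegral_mul _ (measurable_acceptProb_right hp hp' x) hF]
  rfl

/-- Detailed balance for a Metropolis–Hastings kernel whose proposal has a density. -/
theorem mhKernel_isReversible {μ : Measure E} [SFinite μ] {q : E → E → ℝ≥0∞}
    (hq : Measurable (Function.uncurry q)) (hQ : ∀ᵐ x ∂μ, Q x = μ.withDensity (q x))
    {g : E → ℝ≥0∞} (hg : Measurable g)
    (hsymm : ∀ᵐ x ∂μ, ∀ᵐ y ∂μ,
      g x * (q x y * acceptProb p p' x y) = g y * (q y x * acceptProb p p' y x)) :
    (mhKernel Q p p' hp hp').IsReversible (μ.withDensity g) := by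
  have ha := measurable_acceptProb hp hp'
  have hqx : ∀ x, Measurable (q x) := fun x => hq.comp measurable_prodMk_left
  have hT : Measurable fun x => 1 - ∫⁻ z, acceptProb p p' x z ∂(Q x) :=
    measurable_const.sub (Measurable.lintegral_kernel_prod_right ha)
  have hF : Measurable (Function.uncurry fun x y => g x * (q x y * acceptProb p p' x y)) := by
    have := (hg.comp measurable_fst).mul (hq.mul ha)
    exact this
  have hFx : ∀ x, Measurable fun y => g x * (q x y * acceptProb p p' x y) := fun x =>
    hF.comp measurable_prodMk_left
  -- The flow from `A` to `B` splits into accepted moves, a double integral with symmetric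
  -- integrand, and rejections, which only charge `A ∩ B`. Each part is symmetric in `A` and `B`.
  have flow : ∀ A B : Set E, MeasurableSet A → MeasurableSet B →
      ∫⁻ x in A, mhKernel Q p p' hp hp' x B ∂(μ.withDensity g) =
        ∫⁻ x in A, ∫⁻ y in B, g x * (q x y * acceptProb p p' x y) ∂μ ∂μ +
        ∫⁻ x in A ∩ B, (1 - ∫⁻ z, acceptProb p p' x z ∂(Q x)) ∂(μ.withDensity g) := by
    intro A B hA hB
    have e1 : ∀ x, mhKernel Q p p' hp hp' x B = ∫⁻ y in B, acceptProb p p' x y ∂(Q x) +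
        B.indicator (fun x => 1 - ∫⁻ z, acceptProb p p' x z ∂(Q x)) x := by
      intro x
      rw [mhKernel_apply, Measure.add_apply, withDensity_apply _ hB, Measure.smul_apply,
        Measure.dirac_apply' _ hB, smul_eq_mul]
      by_cases hx : x ∈ B <;> simp [hx]
    have hm1 : Measurable fun x => B.indicator (fun x => 1 - ∫⁻ z, acceptProb p p' x z ∂(Q x)) x :=
      hT.indicator hB
    have hm2 : Measurable fun x => ∫⁻ y in B, acceptProb p p' x y ∂(Q x) :=
      Measurable.setLIntegral_kernel_prod_right ha hB
    simp only [e1]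
    rw [lintegral_add_right _ hm1, setLIntegral_withDensity_eq_setLIntegral_mul _ hg hm2 hA,
      lintegral_indicator hB, Measure.restrict_restrict hB, Set.inter_comm B A]
    congr 1
    refine lintegral_congr_ae ?_
    filter_upwards [ae_restrict_of_ae hQ] with x hx
    rw [Pi.mul_apply, hx, setLIntegral_withDensity_eq_setLIntegral_mul _ (hqx x)
      (measurable_acceptProb_right hp hp' x) hB, ← lintegral_const_mul _
      ((hqx x).mul (measurable_acceptProb_right hp hp' x))]
    rfl
  intro A B hA hB
  rw [flow A B hA hB, flow B A hB hA, Set.inter_comm B A]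
  congr 1
  rw [lintegral_lintegral_swap hF.aemeasurable]
  have h1 : ∀ᵐ y ∂μ, ∀ᵐ x ∂μ,
      g x * (q x y * acceptProb p p' x y) = g y * (q y x * acceptProb p p' y x) := by
    filter_upwards [hsymm] with y hy
    filter_upwards [hy] with x hx
    exact hx.symm
  refine lintegral_congr_ae ?_
  filter_upwards [ae_restrict_of_ae h1] with y hy
  exact lintegral_congr_ae (ae_restrict_of_ae hy)

end MetropolisHastingsFacts

/-! ### Densities of the Gaussian law and of the MpCN proposal -/

section Density

/-- The density of the standard Gaussian law on `ℝ^d`. -/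
noncomputable def stdGaussianDensity (d : ℕ) (w : RSpace d) : ℝ :=
  ((2 * Real.pi) ^ ((d : ℝ) / 2))⁻¹ * Real.exp (-‖w‖ ^ 2 / 2)

theorem stdGaussianDensity_nonneg (d : ℕ) (w : RSpace d) : 0 ≤ stdGaussianDensity d w := by
  unfold stdGaussianDensity; positivity

theorem measurable_stdGaussianDensity (d : ℕ) : Measurable (stdGaussianDensity d) := by
  unfold stdGaussianDensity; fun_prop

theorem integrable_stdGaussianDensity (d : ℕ) : Integrable (stdGaussianDensity d) := by
  have h := (GaussianFourier.integrable_cexp_neg_mul_sq_norm_add (V := RSpace d)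
    (b := 1 / 2) (by norm_num) 0 0).norm
  refine (h.const_mul ((2 * Real.pi) ^ ((d : ℝ) / 2))⁻¹).congr (ae_of_all _ fun w => ?_)
  simp only [stdGaussianDensity]
  congr 1
  rw [Complex.norm_exp]
  congr 1
  simp [← Complex.ofReal_pow]
  ring

/-- Finite measures are determined by their characteristic functions, and that of the density is an
explicit Gaussian Fourier integral. -/
theorem stdGaussian_eq_withDensity (d : ℕ) : stdGaussian (RSpace d) =
    volume.withDensity fun w => ENNReal.ofReal (stdGaussianDensity d w) := by
  have : IsFiniteMeasure (volume.withDensity fun w => ENNReal.ofReal (stdGaussianDensity d w)) :=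
    isFiniteMeasure_withDensity_ofReal (integrable_stdGaussianDensity d).2
  refine Measure.ext_of_charFun ?_
  funext t
  rw [charFun_stdGaussian, charFun_apply,
    integral_withDensity_eq_integral_toReal_smul (measurable_stdGaussianDensity d).ennreal_ofReal
      (ae_of_all _ fun _ => ENNReal.ofReal_lt_top)]
  have e : ∀ v : RSpace d, (ENNReal.ofReal (stdGaussianDensity d v)).toReal •
      Complex.exp ((inner ℝ v t : ℝ) * Complex.I) =
      (((2 * Real.pi) ^ ((d : ℝ) / 2))⁻¹ : ℝ) *
        Complex.exp (-(1 / 2 : ℂ) * ‖v‖ ^ 2 + Complex.I * (inner ℝ t v : ℝ)) := by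
    intro v
    rw [ENNReal.toReal_ofReal (stdGaussianDensity_nonneg d v), stdGaussianDensity, Complex.real_smul,
      Complex.ofReal_mul, mul_assoc, Complex.ofReal_exp, ← Complex.exp_add, real_inner_comm]
    congr 2
    push_cast
    ring
  simp_rw [e]
  rw [integral_const_mul, GaussianFourier.integral_cexp_neg_mul_sq_norm_add (by norm_num)]
  have e2 : ((Real.pi : ℂ) / (1 / 2)) ^ ((Module.finrank ℝ (RSpace d) : ℂ) / 2) =
      (((2 * Real.pi) ^ ((d : ℝ) / 2) : ℝ) : ℂ) := by
    rw [Complex.ofReal_cpow (by positivity), finrank_euclideanSpace, Fintype.card_fin]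
    push_cast
    congr 1
    ring
  rw [e2, ← mul_assoc, ← Complex.ofReal_mul, inv_mul_cancel₀ (by positivity), Complex.ofReal_one,
    one_mul, Complex.I_sq]
  congr 1
  ring

/-- Change of variables for an affine map in a Lebesgue integral. -/
theorem lintegral_comp_add_smul {d : ℕ} (m : RSpace d) {s : ℝ} (hs : 0 < s) {F : RSpace d → ℝ≥0∞}
    (hF : Measurable F) :
    ∫⁻ w, F (m + s • w) = ENNReal.ofReal ((s ^ d)⁻¹) * ∫⁻ y, F y := by
  have h := Measure.map_addHaar_smul (volume : Measure (RSpace d)) hs.ne'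
  have e1 : ∫⁻ w, F (m + s • w) = ∫⁻ y, F (m + y) ∂(Measure.map (s • ·) volume) := by
    rw [lintegral_map (by fun_prop) (by fun_prop)]
  rw [e1, h, lintegral_smul_measure, lintegral_add_left_eq_self, finrank_euclideanSpace,
    Fintype.card_fin, abs_of_pos (by positivity), smul_eq_mul]

/-- The quadratic form `‖x‖² - 2 √ρ ⟨x, y⟩ + ‖y‖²`. -/
noncomputable def mpcnForm {d : ℕ} (ρ : ℝ) (x y : RSpace d) : ℝ :=
  ‖x‖ ^ 2 - 2 * √ρ * inner ℝ x y + ‖y‖ ^ 2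

/-- Normalizing constant of the MpCN proposal density. -/
noncomputable def mpcnConst (d : ℕ) (ρ : ℝ) : ℝ :=
  ((2 * Real.pi) ^ ((d : ℝ) / 2))⁻¹ * (√(1 - ρ) ^ d)⁻¹ * ((2 : ℝ) ^ ((d : ℝ) / 2))⁻¹ *
    (Real.Gamma ((d : ℝ) / 2))⁻¹ * Real.Gamma d * (2 * (1 - ρ)) ^ d

/-- The density of the MpCN proposal. -/
noncomputable def mpcnDensity (d : ℕ) (ρ : ℝ) (x y : RSpace d) : ℝ :=
  mpcnConst d ρ * ‖x‖ ^ d / mpcnForm ρ x y ^ d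

theorem mpcnForm_comm {d : ℕ} (ρ : ℝ) (x y : RSpace d) : mpcnForm ρ x y = mpcnForm ρ y x := by
  unfold mpcnForm; rw [real_inner_comm]; ring

theorem mpcnForm_smul {d : ℕ} (ρ r : ℝ) (x y : RSpace d) :
    mpcnForm ρ (r • x) (r • y) = r ^ 2 * mpcnForm ρ x y := by
  unfold mpcnForm
  rw [norm_smul, norm_smul, real_inner_smul_left, real_inner_smul_right, mul_pow, mul_pow,
    Real.norm_eq_abs, sq_abs]
  ring

/-! ### Comparison of the quadratic form with `‖x‖² + ‖y‖²` -/

section Bounds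

variable {d : ℕ} {ρ : ℝ}

theorem sqrt_lt_one (hρ1 : ρ < 1) : √ρ < 1 := by
  rw [Real.sqrt_lt' one_pos]; simpa using hρ1

theorem le_mpcnForm (x y : RSpace d) :
    (1 - √ρ) * (‖x‖ ^ 2 + ‖y‖ ^ 2) ≤ mpcnForm ρ x y := by
  unfold mpcnForm
  have h1 := real_inner_le_norm x y
  have h2 : 2 * inner ℝ x y ≤ ‖x‖ ^ 2 + ‖y‖ ^ 2 := by nlinarith [sq_nonneg (‖x‖ - ‖y‖)]
  nlinarith [mul_le_mul_of_nonneg_left h2 (Real.sqrt_nonneg ρ)]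

theorem mpcnForm_le (hρ1 : ρ < 1) (x y : RSpace d) :
    mpcnForm ρ x y ≤ 2 * (‖x‖ ^ 2 + ‖y‖ ^ 2) := by
  unfold mpcnForm
  have h1 := (abs_le.mp (abs_real_inner_le_norm x y)).1
  have h2 : -(2 * inner ℝ x y) ≤ ‖x‖ ^ 2 + ‖y‖ ^ 2 := by nlinarith [sq_nonneg (‖x‖ - ‖y‖)]
  have h3 := mul_le_mul_of_nonneg_left h2 (Real.sqrt_nonneg ρ)
  have h4 := sqrt_lt_one hρ1
  have h5 : √ρ * (‖x‖ ^ 2 + ‖y‖ ^ 2) ≤ 1 * (‖x‖ ^ 2 + ‖y‖ ^ 2) := by gcongr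
  linarith

theorem mpcnForm_pos (hρ1 : ρ < 1) {x : RSpace d} (hx : x ≠ 0) (y : RSpace d) :
    0 < mpcnForm ρ x y := by
  refine lt_of_lt_of_le ?_ (le_mpcnForm x y)
  have := sqrt_lt_one hρ1
  have := norm_pos_iff.mpr hx
  have : 0 < 1 - √ρ := by linarith
  positivity

theorem mpcnConst_pos (hd : 0 < d) (hρ1 : ρ < 1) : 0 < mpcnConst d ρ := by
  unfold mpcnConst
  have h1 : 0 < 1 - ρ := by linarith
  have h2 : (0 : ℝ) < d := by exact_mod_cast hd
  have h3 := Real.Gamma_pos_of_pos h2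
  have h4 := Real.Gamma_pos_of_pos (half_pos h2)
  have h5 := Real.sqrt_pos.mpr h1
  positivity

theorem measurable_mpcnDensity (d : ℕ) (ρ : ℝ) :
    Measurable (Function.uncurry (mpcnDensity d ρ)) := by
  unfold mpcnDensity mpcnForm Function.uncurry
  fun_prop

end Bounds

/-- Integrating out the Gamma variable. -/
theorem lintegral_gammaPDF_mul_gaussian {d : ℕ} (hd : 0 < d) {ρ : ℝ} (hρ0 : 0 < ρ) (hρ1 : ρ < 1)
    {x : RSpace d} (hx : x ≠ 0) (y : RSpace d) :
    ∫⁻ r in Set.Ioi (0 : ℝ), gammaPDF ((d : ℝ) / 2) (‖x‖ ^ 2 / 2) r *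
      (ENNReal.ofReal (((√(1 - ρ) * r ^ (-(1 / 2) : ℝ)) ^ d)⁻¹) *
        ENNReal.ofReal (stdGaussianDensity d
          ((√(1 - ρ) * r ^ (-(1 / 2) : ℝ))⁻¹ • (y - √ρ • x)))) =
      ENNReal.ofReal (mpcnDensity d ρ x y) := by
  have h1ρ : 0 < 1 - ρ := by linarith
  have hdR : (0 : ℝ) < d := by exact_mod_cast hd
  have hΓd := Real.Gamma_pos_of_pos hdR
  have hΓ := Real.Gamma_pos_of_pos (half_pos hdR)
  have hnx := norm_pos_iff.mpr hx
  have hform := mpcnForm_pos hρ1 hx y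
  -- The exponents of the Gamma and Gaussian densities add up to `-R r`, and the Gaussian scaling
  -- contributes `r^{d/2}`. The integrand in `r` is thus the proposal density times the density of
  -- Gamma with shape `d` and rate `R`, which integrates to `1`.
  obtain ⟨R, hR⟩ : ∃ R, R = mpcnForm ρ x y / (2 * (1 - ρ)) := ⟨_, rfl⟩
  have hR0 : 0 < R := by rw [hR]; positivity
  have hexp : ‖x‖ ^ 2 / 2 + ‖y - √ρ • x‖ ^ 2 / (2 * (1 - ρ)) = R := by
    rw [hR, mpcnForm, norm_sub_sq_real, real_inner_smul_right, norm_smul, Real.norm_eq_abs,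
      abs_of_nonneg (Real.sqrt_nonneg ρ), mul_pow, Real.sq_sqrt hρ0.le, real_inner_comm]
    field_simp
    ring
  have hpt : ∀ r ∈ Set.Ioi (0 : ℝ), gammaPDF ((d : ℝ) / 2) (‖x‖ ^ 2 / 2) r *
      (ENNReal.ofReal (((√(1 - ρ) * r ^ (-(1 / 2) : ℝ)) ^ d)⁻¹) *
        ENNReal.ofReal (stdGaussianDensity d
          ((√(1 - ρ) * r ^ (-(1 / 2) : ℝ))⁻¹ • (y - √ρ • x)))) =
      ENNReal.ofReal (mpcnDensity d ρ x y) * gammaPDF d R r := by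
    intro r hr
    have hr : 0 < r := hr
    have hs : 0 < √(1 - ρ) := Real.sqrt_pos.mpr h1ρ
    have hrs : 0 < √r := Real.sqrt_pos.mpr hr
    have e0 : r ^ (-(1 / 2) : ℝ) = (√r)⁻¹ := by
      rw [Real.rpow_neg hr.le, Real.sqrt_eq_rpow]
    have hq0 : 0 ≤ mpcnDensity d ρ x y := by
      have := mpcnConst_pos hd hρ1
      unfold mpcnDensity; positivity
    have e1 : r ^ ((d : ℝ) / 2 - 1) * (√r) ^ d = r ^ ((d : ℝ) - 1) := by
      have : (√r) ^ d = r ^ ((d : ℝ) / 2) := by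
        rw [Real.sqrt_eq_rpow, ← Real.rpow_natCast, ← Real.rpow_mul hr.le]
        congr 1; ring
      rw [this, ← Real.rpow_add hr]
      congr 1; ring
    have e2 : (‖x‖ ^ 2 / 2) ^ ((d : ℝ) / 2) = ‖x‖ ^ d * ((2 : ℝ) ^ ((d : ℝ) / 2))⁻¹ := by
      rw [Real.div_rpow (by positivity) (by norm_num), ← Real.rpow_natCast ‖x‖ 2,
        ← Real.rpow_mul hnx.le, div_eq_mul_inv]
      congr 1
      rw [← Real.rpow_natCast ‖x‖ d]
      congr 1; push_cast; ring
    have e3 : Real.exp (-(‖x‖ ^ 2 / 2 * r)) *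
        Real.exp (-‖(√(1 - ρ) * (√r)⁻¹)⁻¹ • (y - √ρ • x)‖ ^ 2 / 2) = Real.exp (-(R * r)) := by
      rw [← Real.exp_add, ← hexp, norm_smul, mul_pow, Real.norm_eq_abs, sq_abs, inv_pow, mul_pow,
        inv_pow, Real.sq_sqrt h1ρ.le, Real.sq_sqrt hr.le]
      congr 1
      field_simp
      ring
    rw [gammaPDF_of_nonneg hr.le, gammaPDF_of_nonneg hr.le, e0,
      ← ENNReal.ofReal_mul (by positivity), ← ENNReal.ofReal_mul (by positivity),
      ← ENNReal.ofReal_mul hq0]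
    congr 1
    rw [stdGaussianDensity, ← e3, ← e1, e2, Real.rpow_natCast, mpcnDensity, mpcnConst]
    have e4 : R ^ d = mpcnForm ρ x y ^ d / (2 * (1 - ρ)) ^ d := by rw [hR, div_pow]
    rw [e4, mul_pow (√(1 - ρ)), inv_pow]
    field_simp
  have hgpdf : Measurable (gammaPDF d R) := (measurable_gammaPDFReal _ _).ennreal_ofReal
  rw [setLIntegral_congr_fun measurableSet_Ioi hpt, lintegral_const_mul _ hgpdf]
  have e5 : ∫⁻ r in Set.Ioi (0 : ℝ), gammaPDF d R r = 1 := by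
    have h := lintegral_add_compl (μ := volume) (gammaPDF d R) (measurableSet_Ici (a := (0 : ℝ)))
    rw [Set.compl_Ici, lintegral_gammaPDF_of_nonpos le_rfl, add_zero,
      lintegral_gammaPDF_eq_one hdR hR0] at h
    rw [← h]
    exact setLIntegral_congr Ioi_ae_eq_Ici
  rw [e5, mul_one]

/-- The MpCN proposal started at `x ≠ 0` has density `mpcnDensity d ρ x`. -/
theorem mpcnProposal_eq_withDensity {d : ℕ} {ρ : ℝ} (hρ0 : 0 < ρ) (hρ1 : ρ < 1)
    {x : RSpace d} (hx : x ≠ 0) : mpcnProposal d ρ x =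
      volume.withDensity fun y => ENNReal.ofReal (mpcnDensity d ρ x y) := by
  classical
  have hd : 0 < d := by
    rcases Nat.eq_zero_or_pos d with h | h
    · subst h
      exact absurd (Subsingleton.elim x 0) hx
    · exact h
  have h1ρ : 0 < 1 - ρ := by linarith
  have hGm := measurable_stdGaussianDensity d
  ext A hA
  change mpcnProposalMeasure d ρ x A = _
  rw [mpcnProposalMeasure, if_neg hx, withDensity_apply _ hA, Measure.map_apply (by fun_prop) hA]
  have hF : Measurable (A.indicator (1 : RSpace d → ℝ≥0∞)) := measurable_one.indicator hA
  rw [stdGaussian_eq_withDensity]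
  have hfin : IsFiniteMeasure
      (volume.withDensity fun w => ENNReal.ofReal (stdGaussianDensity d w)) := by
    rw [← stdGaussian_eq_withDensity]; infer_instance
  rw [Measure.prod_apply ((by fun_prop : Measurable fun q : ℝ × RSpace d =>
    √ρ • x + √(1 - ρ) • (q.1 ^ (-(1 / 2) : ℝ)) • q.2) hA)]
  -- Given `r`, the substitution `y = √ρ x + s w` with `s = √(1-ρ) r^{-1/2}` moves the Gaussian
  -- integral to the variable `y`. Only `r > 0` matters, since the Gamma density vanishes for `r <
  -- 0`.
  have hinner : ∀ r ∈ Set.Ioi (0 : ℝ),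
      (volume.withDensity fun w => ENNReal.ofReal (stdGaussianDensity d w))
        (Prod.mk r ⁻¹' ((fun q : ℝ × RSpace d =>
          √ρ • x + √(1 - ρ) • (q.1 ^ (-(1 / 2) : ℝ)) • q.2) ⁻¹' A)) =
      ∫⁻ y, A.indicator 1 y * (ENNReal.ofReal (((√(1 - ρ) * r ^ (-(1 / 2) : ℝ)) ^ d)⁻¹) *
        ENNReal.ofReal (stdGaussianDensity d
          ((√(1 - ρ) * r ^ (-(1 / 2) : ℝ))⁻¹ • (y - √ρ • x)))) := by
    intro r hr
    obtain ⟨s, hs⟩ : ∃ s, s = √(1 - ρ) * r ^ (-(1 / 2) : ℝ) := ⟨_, rfl⟩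
    have hs0 : 0 < s := by
      rw [hs]
      have := Real.sqrt_pos.mpr h1ρ
      have := Real.rpow_pos_of_pos (Set.mem_Ioi.mp hr) (-(1 / 2))
      positivity
    have hmB : MeasurableSet (Prod.mk r ⁻¹' ((fun q : ℝ × RSpace d =>
          √ρ • x + √(1 - ρ) • (q.1 ^ (-(1 / 2) : ℝ)) • q.2) ⁻¹' A)) :=
      measurable_prodMk_left ((by fun_prop : Measurable fun q : ℝ × RSpace d =>
        √ρ • x + √(1 - ρ) • (q.1 ^ (-(1 / 2) : ℝ)) • q.2) hA)
    rw [← hs, withDensity_apply _ hmB, ← lintegral_indicator hmB]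
    have hm2 : Measurable fun y => A.indicator 1 y *
        ENNReal.ofReal (stdGaussianDensity d (s⁻¹ • (y - √ρ • x))) := by fun_prop
    have h2 := lintegral_comp_add_smul (√ρ • x) hs0 hm2
    have e1 : ∀ w : RSpace d, (Prod.mk r ⁻¹' ((fun q : ℝ × RSpace d =>
          √ρ • x + √(1 - ρ) • (q.1 ^ (-(1 / 2) : ℝ)) • q.2) ⁻¹' A)).indicator
        (fun w => ENNReal.ofReal (stdGaussianDensity d w)) w =
        A.indicator 1 (√ρ • x + s • w) *
          ENNReal.ofReal (stdGaussianDensity d (s⁻¹ • (√ρ • x + s • w - √ρ • x))) := by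
      intro w
      rw [add_sub_cancel_left, inv_smul_smul₀ hs0.ne', hs, mul_smul]
      rw [Set.indicator_apply, Set.indicator_apply]
      simp only [Set.mem_preimage, Pi.one_apply, ite_mul, one_mul, zero_mul]
    rw [lintegral_congr e1, h2, ← lintegral_const_mul _ hm2]
    refine lintegral_congr fun y => ?_
    ring
  have hΦ : Measurable fun q : ℝ × RSpace d => A.indicator 1 q.2 *
      (ENNReal.ofReal (((√(1 - ρ) * q.1 ^ (-(1 / 2) : ℝ)) ^ d)⁻¹) *
        ENNReal.ofReal (stdGaussianDensity d
          ((√(1 - ρ) * q.1 ^ (-(1 / 2) : ℝ))⁻¹ • (q.2 - √ρ • x)))) := by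
    fun_prop
  have hgpdf : Measurable (gammaPDF ((d : ℝ) / 2) (‖x‖ ^ 2 / 2)) :=
    (measurable_gammaPDFReal _ _).ennreal_ofReal
  rw [gammaMeasure, lintegral_withDensity_eq_lintegral_mul _ hgpdf
    (measurable_measure_prodMk_left ((by fun_prop : Measurable fun q : ℝ × RSpace d =>
    √ρ • x + √(1 - ρ) • (q.1 ^ (-(1 / 2) : ℝ)) • q.2) hA))]
  rw [← lintegral_add_compl _ (measurableSet_Ici (a := (0 : ℝ))), Set.compl_Ici]
  have hneg : ∫⁻ r in Set.Iio (0 : ℝ), (gammaPDF ((d : ℝ) / 2) (‖x‖ ^ 2 / 2) * fun r =>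
      (volume.withDensity fun w => ENNReal.ofReal (stdGaussianDensity d w))
        (Prod.mk r ⁻¹' ((fun q : ℝ × RSpace d =>
          √ρ • x + √(1 - ρ) • (q.1 ^ (-(1 / 2) : ℝ)) • q.2) ⁻¹' A))) r = 0 := by
    rw [setLIntegral_congr_fun (g := fun _ => 0) measurableSet_Iio, lintegral_zero]
    intro r hr
    simp [gammaPDF_of_neg (Set.mem_Iio.mp hr)]
  rw [hneg, add_zero, ← setLIntegral_congr Ioi_ae_eq_Ici]
  have hpos : ∀ r ∈ Set.Ioi (0 : ℝ), (gammaPDF ((d : ℝ) / 2) (‖x‖ ^ 2 / 2) * fun r =>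
      (volume.withDensity fun w => ENNReal.ofReal (stdGaussianDensity d w))
        (Prod.mk r ⁻¹' ((fun q : ℝ × RSpace d =>
          √ρ • x + √(1 - ρ) • (q.1 ^ (-(1 / 2) : ℝ)) • q.2) ⁻¹' A))) r =
      ∫⁻ y, gammaPDF ((d : ℝ) / 2) (‖x‖ ^ 2 / 2) r * (A.indicator 1 y *
        (ENNReal.ofReal (((√(1 - ρ) * r ^ (-(1 / 2) : ℝ)) ^ d)⁻¹) *
        ENNReal.ofReal (stdGaussianDensity d
          ((√(1 - ρ) * r ^ (-(1 / 2) : ℝ))⁻¹ • (y - √ρ • x))))) := by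
    intro r hr
    rw [Pi.mul_apply, hinner r hr]
    exact (lintegral_const_mul _ (hΦ.comp measurable_prodMk_left)).symm
  rw [setLIntegral_congr_fun measurableSet_Ioi hpos, lintegral_lintegral_swap
    (((hgpdf.comp measurable_fst).mul hΦ).aemeasurable), ← lintegral_indicator hA]
  refine lintegral_congr fun y => ?_
  by_cases hy : y ∈ A
  · simp only [Set.indicator_of_mem hy, Pi.one_apply, one_mul]
    exact lintegral_gammaPDF_mul_gaussian hd hρ0 hρ1 hx y
  · simp [Set.indicator_of_notMem hy]

end Density

/-! ### The drift functional of the MpCN kernel -/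

section Drift

/-- The density `p(x) ‖x‖^d` of the target with respect to `‖x‖^{-d} dx`. -/
noncomputable def radialWeight {d : ℕ} (p : RSpace d → ℝ) (x : RSpace d) : ℝ := p x * ‖x‖ ^ d

/-- The Lyapunov function `(p(x) ‖x‖^d)^{-1/2}`. -/
noncomputable def mpcnLyapunov {d : ℕ} (p : RSpace d → ℝ) (x : RSpace d) : ℝ :=
  (√(radialWeight p x))⁻¹

/-! ### The one-step rate as a function of the ratio of densities -/

/-- The conditional mean of `V(X₁) / V(X₀)` in a Metropolis–Hastings step, for `V` the inverse
square root of the target density, given that the ratio of the densities at the proposed and the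
current state is `t`. -/
noncomputable def mhRate (t : ℝ) : ℝ := min 1 t / √t + (1 - min 1 t)

theorem measurable_mhRate : Measurable mhRate := by unfold mhRate; fun_prop

theorem mhRate_of_le_one {t : ℝ} (ht : t ≤ 1) : mhRate t = √t + (1 - t) := by
  rw [mhRate, min_eq_right ht, Real.div_sqrt]

theorem mhRate_of_one_le {t : ℝ} (ht : 1 ≤ t) : mhRate t = (√t)⁻¹ := by
  rw [mhRate, min_eq_left ht]; simp

theorem mhRate_nonneg {t : ℝ} (ht : 0 ≤ t) : 0 ≤ mhRate t := by
  have : 0 ≤ min 1 t := le_min zero_le_one ht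
  have h2 : min 1 t ≤ 1 := min_le_left _ _
  unfold mhRate
  have : 0 ≤ 1 - min 1 t := by linarith
  positivity

theorem mhRate_le_one_add_sqrt {t : ℝ} (ht : 0 ≤ t) : mhRate t ≤ 1 + √t := by
  rcases le_total t 1 with h | h
  · rw [mhRate_of_le_one h]; linarith
  · rw [mhRate_of_one_le h]
    have h1 : 1 ≤ √t := Real.one_le_sqrt.mpr h
    have := inv_le_one_of_one_le₀ h1
    linarith

/-- The worst ratio is `t = 1/4`, where `√t + 1 - t` attains its maximum `5/4`. -/
theorem mhRate_le {t : ℝ} (ht : 0 ≤ t) : mhRate t ≤ 5 / 4 := by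
  rcases le_total t 1 with h | h
  · rw [mhRate_of_le_one h]
    nlinarith [Real.sq_sqrt ht, sq_nonneg (√t - 1 / 2)]
  · rw [mhRate_of_one_le h]
    have := inv_le_one_of_one_le₀ (Real.one_le_sqrt.mpr h)
    linarith

theorem mhRate_le_half {t : ℝ} (ht : 4 ≤ t) : mhRate t ≤ 1 / 2 := by
  rw [mhRate_of_one_le (by linarith)]
  have : (2 : ℝ) ≤ √t := by
    rw [Real.le_sqrt (by norm_num) (by linarith)]; linarith
  rw [one_div]
  exact inv_anti₀ (by norm_num) this

/-- A single ratio may give a rate above `1`, but averaging `t` with `1/t` gives at most `1`, with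
equality only for `t = 1`. This is the source of the strict drift under regular variation. -/
theorem mhRate_add_mhRate_inv {t : ℝ} (ht : 0 < t) :
    mhRate t + mhRate t⁻¹ = 2 - (1 - √(min t t⁻¹)) ^ 2 := by
  rcases le_total t 1 with h | h
  · have h1 : 1 ≤ t⁻¹ := (one_le_inv₀ ht).mpr h
    rw [mhRate_of_le_one h, mhRate_of_one_le h1, min_eq_left (h.trans h1), Real.sqrt_inv, inv_inv]
    nlinarith [Real.sq_sqrt ht.le]
  · have h1 : t⁻¹ ≤ 1 := inv_le_one_of_one_le₀ h
    rw [mhRate_of_one_le h, mhRate_of_le_one h1, min_eq_right (h1.trans h), ← Real.sqrt_inv]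
    nlinarith [Real.sq_sqrt (inv_pos.mpr ht).le]

theorem continuousAt_mhRate {t : ℝ} (ht : 0 < t) : ContinuousAt mhRate t := by
  unfold mhRate
  have : √t ≠ 0 := (Real.sqrt_pos.mpr ht).ne'
  fun_prop (disch := assumption)

/-! ### Comparison of the proposal density with a radial weight -/

/-- The weight `(1 + ‖z‖²)^{-d}`. -/
noncomputable def tailWeight {d : ℕ} (z : RSpace d) : ℝ := ((1 + ‖z‖ ^ 2) ^ d)⁻¹

theorem tailWeight_pos {d : ℕ} (z : RSpace d) : 0 < tailWeight z := by
  unfold tailWeight; positivity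

theorem measurable_tailWeight {d : ℕ} : Measurable (tailWeight (d := d)) := by
  unfold tailWeight; fun_prop

theorem integrable_tailWeight {d : ℕ} (hd : 0 < d) : Integrable (tailWeight (d := d)) := by
  have h := integrable_rpow_neg_one_add_norm_sq (E := RSpace d) (μ := volume) (r := 2 * d) (by
    rw [finrank_euclideanSpace, Fintype.card_fin]
    have : (0 : ℝ) < d := by exact_mod_cast hd
    linarith)
  refine h.congr (ae_of_all _ fun z => ?_)
  simp only [tailWeight]
  rw [neg_div, mul_div_cancel_left₀ _ (by norm_num : (2 : ℝ) ≠ 0), Real.rpow_neg (by positivity),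
    Real.rpow_natCast]

variable {d : ℕ} {ρ : ℝ}

theorem mpcnDensity_nonneg (hd : 0 < d) (hρ1 : ρ < 1) {x : RSpace d} (hx : x ≠ 0) (y : RSpace d) :
    0 ≤ mpcnDensity d ρ x y := by
  have := mpcnConst_pos hd hρ1
  have := mpcnForm_pos hρ1 hx y
  unfold mpcnDensity; positivity

/-- The majorant is independent of the unit vector `e`. Limits in `x` can thus be taken against a
fixed integrable weight although the direction `x/‖x‖` need not converge. -/
theorem mpcnDensity_le (hd : 0 < d) (hρ1 : ρ < 1) {e : RSpace d} (he : ‖e‖ = 1) (z : RSpace d) :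
    mpcnDensity d ρ e z ≤ mpcnConst d ρ / (1 - √ρ) ^ d * tailWeight z := by
  have h1 := mpcnConst_pos hd hρ1
  have h2 := sqrt_lt_one hρ1
  have h3 : 0 < 1 - √ρ := by linarith
  have h4 := le_mpcnForm (ρ := ρ) e z
  rw [he, one_pow] at h4
  rw [mpcnDensity, he, one_pow, mul_one, tailWeight, ← div_eq_mul_inv, div_div, ← mul_pow]
  gcongr

/-- Being independent of `e`, this minorant makes the drift gains uniform over directions. -/
theorem le_mpcnDensity (hd : 0 < d) (hρ1 : ρ < 1) {e : RSpace d} (he : ‖e‖ = 1) (z : RSpace d) :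
    mpcnConst d ρ / 2 ^ d * tailWeight z ≤ mpcnDensity d ρ e z := by
  have h1 := mpcnConst_pos hd hρ1
  have he0 : e ≠ 0 := by rintro rfl; simp at he
  have h3 := mpcnForm_pos hρ1 he0 z
  have h4 := mpcnForm_le hρ1 e z
  rw [he, one_pow] at h4
  rw [mpcnDensity, he, one_pow, mul_one, tailWeight, ← div_eq_mul_inv, div_div, ← mul_pow]
  gcongr

theorem measurable_mpcnDensity_right (x : RSpace d) : Measurable (mpcnDensity d ρ x) := by
  unfold mpcnDensity mpcnForm
  fun_prop

theorem integrable_mpcnDensity (hd : 0 < d) (hρ1 : ρ < 1) {e : RSpace d} (he : ‖e‖ = 1) :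
    Integrable (mpcnDensity d ρ e) := by
  have he0 : e ≠ 0 := by rintro rfl; simp at he
  refine ((integrable_tailWeight hd).const_mul (mpcnConst d ρ / (1 - √ρ) ^ d)).mono'
    (measurable_mpcnDensity_right e).aestronglyMeasurable (ae_of_all _ fun z => ?_)
  rw [Real.norm_of_nonneg (mpcnDensity_nonneg hd hρ1 he0 z)]
  exact mpcnDensity_le hd hρ1 he z

theorem integral_mpcnProposal (hd : 0 < d) (hρ0 : 0 < ρ) (hρ1 : ρ < 1) {x : RSpace d} (hx : x ≠ 0)
    (F : RSpace d → ℝ) :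
    ∫ y, F y ∂(mpcnProposal d ρ x) = ∫ y, mpcnDensity d ρ x y * F y := by
  rw [mpcnProposal_eq_withDensity hρ0 hρ1 hx, integral_withDensity_eq_integral_toReal_smul
    (measurable_mpcnDensity_right x).ennreal_ofReal (ae_of_all _ fun _ => ENNReal.ofReal_lt_top)]
  refine integral_congr_ae (ae_of_all _ fun y => ?_)
  simp only
  rw [ENNReal.toReal_ofReal (mpcnDensity_nonneg hd hρ1 hx y), smul_eq_mul]

theorem integral_mpcnDensity (hd : 0 < d) (hρ0 : 0 < ρ) (hρ1 : ρ < 1) {x : RSpace d} (hx : x ≠ 0) :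
    ∫ y, mpcnDensity d ρ x y = 1 := by
  have h := integral_mpcnProposal hd hρ0 hρ1 hx (fun _ => (1 : ℝ))
  simpa using h.symm

/-- Scaling of the proposal: a step from `x` is a step from `x / ‖x‖`, dilated by `‖x‖`. -/
theorem integral_mpcnProposal_scale (hd : 0 < d) (hρ0 : 0 < ρ) (hρ1 : ρ < 1) {x : RSpace d}
    (hx : x ≠ 0) (F : RSpace d → ℝ) :
    ∫ y, F y ∂(mpcnProposal d ρ x) = ∫ z, mpcnDensity d ρ (‖x‖⁻¹ • x) z * F (‖x‖ • z) := by
  have hnx := norm_pos_iff.mpr hx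
  rw [integral_mpcnProposal hd hρ0 hρ1 hx]
  have h := Measure.integral_comp_smul (volume : Measure (RSpace d))
    (fun y => mpcnDensity d ρ x y * F y) ‖x‖
  rw [finrank_euclideanSpace, Fintype.card_fin, smul_eq_mul, abs_of_pos (by positivity),
    eq_inv_mul_iff_mul_eq₀ (by positivity), ← integral_const_mul] at h
  rw [← h]
  refine integral_congr_ae (ae_of_all _ fun z => ?_)
  simp only
  rw [← mul_assoc]
  congr 1
  have e1 : mpcnForm ρ x (‖x‖ • z) = ‖x‖ ^ 2 * mpcnForm ρ (‖x‖⁻¹ • x) z := by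
    rw [← mpcnForm_smul, smul_inv_smul₀ hnx.ne']
  have hf : 0 < mpcnForm ρ (‖x‖⁻¹ • x) z :=
    mpcnForm_pos hρ1 (smul_ne_zero (inv_ne_zero hnx.ne') hx) z
  have e2 : ‖‖x‖⁻¹ • x‖ = 1 := by rw [norm_smul, norm_inv, norm_norm, inv_mul_cancel₀ hnx.ne']
  rw [mpcnDensity, mpcnDensity, e1, e2, mul_pow, one_pow]
  field_simp
  ring

/-! ### The drift ratio -/

/-- The ratio `P V (x) / V (x)` for the Lyapunov function `V` of the MpCN kernel. -/
noncomputable def driftRatio (d : ℕ) (ρ : ℝ) (p : RSpace d → ℝ) (x : RSpace d) : ℝ :=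
  ∫ z, mpcnDensity d ρ (‖x‖⁻¹ • x) z * mhRate (radialWeight p (‖x‖ • z) / radialWeight p x)

variable {p : RSpace d → ℝ}

theorem measurable_radialWeight (hp : Measurable p) : Measurable (radialWeight p) := by
  unfold radialWeight; fun_prop

theorem radialWeight_nonneg (hp0 : ∀ x, 0 < p x) (x : RSpace d) : 0 ≤ radialWeight p x :=
  mul_nonneg (hp0 x).le (by positivity)

theorem radialWeight_pos (hp0 : ∀ x, 0 < p x) {x : RSpace d} (hx : x ≠ 0) :
    0 < radialWeight p x :=
  mul_pos (hp0 x) (pow_pos (norm_pos_iff.mpr hx) d)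

theorem measurable_mpcnLyapunov (hp : Measurable p) : Measurable (mpcnLyapunov p) := by
  have := measurable_radialWeight hp
  unfold mpcnLyapunov; fun_prop

theorem mpcnLyapunov_nonneg (p : RSpace d → ℝ) (x : RSpace d) : 0 ≤ mpcnLyapunov p x := by
  unfold mpcnLyapunov; positivity

theorem acceptProb_eq_radialWeight (p : RSpace d → ℝ) (x y : RSpace d) :
    acceptProb p (fun x => (‖x‖ ^ d)⁻¹) x y =
      ENNReal.ofReal (min 1 (radialWeight p y / radialWeight p x)) := by
  unfold acceptProb radialWeight
  congr 2
  rw [mul_comm (p x), mul_comm (p y), mul_comm (p y), mul_comm (p x)]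
  simp only [div_eq_mul_inv, mul_inv, inv_inv]
  ring

/-- For an accepted proposal `V(y) = V(x) t^{-1/2}` with `t` the ratio of radial weights, and a
rejection leaves `V(x)`; dilation by `‖x‖` then reduces the mean to a start on the unit sphere. -/
theorem lintegral_mpcnLyapunov (hd : 0 < d) (hρ0 : 0 < ρ) (hρ1 : ρ < 1) (hp : Measurable p)
    (hp0 : ∀ x, 0 < p x) {x : RSpace d} (hx : x ≠ 0) :
    ∫⁻ y, ENNReal.ofReal (mpcnLyapunov p y) ∂(mpcnKernel d ρ p hp x) =
      ENNReal.ofReal (driftRatio d ρ p x * mpcnLyapunov p x) := by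
  have hw := measurable_radialWeight hp
  have hwx := radialWeight_pos hp0 hx
  have ht0 : ∀ y, 0 ≤ radialWeight p y / radialWeight p x := fun y =>
    div_nonneg (radialWeight_nonneg hp0 y) hwx.le
  have hVx := mpcnLyapunov_nonneg p x
  have hm0 : ∀ y, 0 ≤ min 1 (radialWeight p y / radialWeight p x) := fun y =>
    le_min zero_le_one (ht0 y)
  have hm1 : ∀ y, min 1 (radialWeight p y / radialWeight p x) ≤ 1 := fun y => min_le_left _ _
  have hψ0 : ∀ y, 0 ≤ min 1 (radialWeight p y / radialWeight p x) /
      √(radialWeight p y / radialWeight p x) := fun y => div_nonneg (hm0 y) (Real.sqrt_nonneg _)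
  have hψm : Measurable fun y => min 1 (radialWeight p y / radialWeight p x) /
      √(radialWeight p y / radialWeight p x) := by fun_prop
  have hmm : Measurable fun y => min 1 (radialWeight p y / radialWeight p x) := by fun_prop
  have him : Integrable (fun y => min 1 (radialWeight p y / radialWeight p x))
      (mpcnProposal d ρ x) := by
    refine Integrable.of_bound hmm.aestronglyMeasurable 1 (ae_of_all _ fun y => ?_)
    rw [Real.norm_of_nonneg (hm0 y)]; exact hm1 y
  have hiψ : Integrable (fun y => min 1 (radialWeight p y / radialWeight p x) /
      √(radialWeight p y / radialWeight p x)) (mpcnProposal d ρ x) := by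
    refine Integrable.of_bound hψm.aestronglyMeasurable (5 / 4) (ae_of_all _ fun y => ?_)
    rw [Real.norm_of_nonneg (hψ0 y)]
    have := mhRate_le (ht0 y)
    have := hm1 y
    unfold mhRate at *
    linarith
  -- The convention `0⁻¹ = 0` makes this hold at `y = 0` too, where both sides vanish.
  have hpt : ∀ y, acceptProb p (fun x => (‖x‖ ^ d)⁻¹) x y * ENNReal.ofReal (mpcnLyapunov p y) =
      ENNReal.ofReal (mpcnLyapunov p x) *
        ENNReal.ofReal (min 1 (radialWeight p y / radialWeight p x) /
          √(radialWeight p y / radialWeight p x)) := by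
    intro y
    rw [acceptProb_eq_radialWeight, ← ENNReal.ofReal_mul (hm0 y), ← ENNReal.ofReal_mul hVx]
    congr 1
    have h1 : √(radialWeight p x) ≠ 0 := (Real.sqrt_pos.mpr hwx).ne'
    rw [mpcnLyapunov, mpcnLyapunov, Real.sqrt_div' _ hwx.le]
    simp only [div_eq_mul_inv, mul_inv, inv_inv]
    field_simp
  unfold mpcnKernel
  rw [lintegral_mhKernel (measurable_mpcnLyapunov hp).ennreal_ofReal, lintegral_congr hpt,
    lintegral_const_mul _ hψm.ennreal_ofReal]
  simp only [acceptProb_eq_radialWeight]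
  rw [← ofReal_integral_eq_lintegral_ofReal hiψ (ae_of_all _ hψ0),
    ← ofReal_integral_eq_lintegral_ofReal him (ae_of_all _ hm0)]
  have hle : ∫ y, min 1 (radialWeight p y / radialWeight p x) ∂(mpcnProposal d ρ x) ≤ 1 := by
    have := integral_mono him (integrable_const 1) hm1
    simpa using this
  have e1 : driftRatio d ρ p x = ∫ y, min 1 (radialWeight p y / radialWeight p x) /
      √(radialWeight p y / radialWeight p x) ∂(mpcnProposal d ρ x) +
      (1 - ∫ y, min 1 (radialWeight p y / radialWeight p x) ∂(mpcnProposal d ρ x)) := by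
    rw [driftRatio, ← integral_mpcnProposal_scale hd hρ0 hρ1 hx
      (fun y => mhRate (radialWeight p y / radialWeight p x))]
    unfold mhRate
    have hi1 : Integrable (fun y => 1 - min 1 (radialWeight p y / radialWeight p x))
        (mpcnProposal d ρ x) := (integrable_const 1).sub him
    rw [integral_add hiψ hi1, integral_sub (integrable_const 1) him]
    simp
  rw [e1, add_mul, ENNReal.ofReal_add (mul_nonneg (integral_nonneg hψ0) hVx)
    (mul_nonneg (by linarith) hVx), ENNReal.ofReal_mul (integral_nonneg hψ0),
    ENNReal.ofReal_mul (by linarith), ENNReal.ofReal_sub _ (integral_nonneg hm0),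
    ENNReal.ofReal_one, mul_comm]

theorem norm_inv_norm_smul {x : RSpace d} (hx : x ≠ 0) : ‖‖x‖⁻¹ • x‖ = 1 := by
  rw [norm_smul, norm_inv, norm_norm, inv_mul_cancel₀ (norm_ne_zero_iff.mpr hx)]

/-- A bounded function is integrable against the proposal density. -/
theorem integrable_mpcnDensity_mul (hd : 0 < d) (hρ1 : ρ < 1) {e : RSpace d} (he : ‖e‖ = 1)
    {F : RSpace d → ℝ} (hF : Measurable F) {C : ℝ} (hC : ∀ z, |F z| ≤ C) :
    Integrable fun z => mpcnDensity d ρ e z * F z :=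
  (integrable_mpcnDensity hd hρ1 he).mul_bdd hF.aestronglyMeasurable (ae_of_all _ hC)

theorem integrable_tailWeight_mul (hd : 0 < d)
    {F : RSpace d → ℝ} (hF : Measurable F) {C : ℝ} (hC : ∀ z, |F z| ≤ C) :
    Integrable fun z => tailWeight z * F z :=
  (integrable_tailWeight hd).mul_bdd hF.aestronglyMeasurable (ae_of_all _ hC)

theorem abs_mhRate_le {t : ℝ} (ht : 0 ≤ t) : |mhRate t| ≤ 5 / 4 := by
  rw [abs_of_nonneg (mhRate_nonneg ht)]; exact mhRate_le ht

theorem driftRatio_le (hd : 0 < d) (hρ0 : 0 < ρ) (hρ1 : ρ < 1) (hp : Measurable p)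
    (hp0 : ∀ x, 0 < p x) {x : RSpace d} (hx : x ≠ 0) : driftRatio d ρ p x ≤ 5 / 4 := by
  have he := norm_inv_norm_smul hx
  have he0 : ‖x‖⁻¹ • x ≠ 0 := by intro h; rw [h] at he; simp at he
  have hw := measurable_radialWeight hp
  have ht0 : ∀ y, 0 ≤ radialWeight p y / radialWeight p x := fun y =>
    div_nonneg (radialWeight_nonneg hp0 y) (radialWeight_nonneg hp0 x)
  have hmr := measurable_mhRate
  calc driftRatio d ρ p x ≤ ∫ z, mpcnDensity d ρ (‖x‖⁻¹ • x) z * (5 / 4) := by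
        refine integral_mono (integrable_mpcnDensity_mul hd hρ1 he (by fun_prop)
          fun z => abs_mhRate_le (ht0 _)) ((integrable_mpcnDensity hd hρ1 he).mul_const _) fun z => ?_
        exact mul_le_mul_of_nonneg_left (mhRate_le (ht0 _)) (mpcnDensity_nonneg hd hρ1 he0 z)
    _ = 5 / 4 := by rw [integral_mul_const, integral_mpcnDensity hd hρ0 hρ1 he0, one_mul]

/-! ### Inversion symmetry and drift under regular variation -/

/-- The proposal from a unit vector is invariant under the inversion in the unit sphere. -/
theorem integral_mpcnDensity_inv_norm (hρ1 : ρ < 1) {e : RSpace d}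
    (he : ‖e‖ = 1) (G : ℝ → ℝ) :
    ∫ z, mpcnDensity d ρ e z * G ‖z‖⁻¹ = ∫ z, mpcnDensity d ρ e z * G ‖z‖ := by
  have he0 : e ≠ 0 := by rintro rfl; simp at he
  have : Nontrivial (RSpace d) := ⟨e, 0, he0⟩
  have hinv : ∀ z : RSpace d, EuclideanGeometry.inversion 0 1 z = (‖z‖ ^ 2)⁻¹ • z := by
    intro z; simp [EuclideanGeometry.inversion_def, dist_zero_right]
  have h := integral_image_eq_integral_abs_det_fderiv_smul (volume : Measure (RSpace d))
    (s := {0}ᶜ) (f := EuclideanGeometry.inversion 0 1)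
    (measurableSet_singleton 0).compl
    (fun x hx => (EuclideanGeometry.hasFDerivAt_inversion (R := 1) hx).hasFDerivWithinAt)
    (EuclideanGeometry.inversion_injective 0 one_ne_zero).injOn
    (fun z => mpcnDensity d ρ e z * G ‖z‖)
  have himg : EuclideanGeometry.inversion (0 : RSpace d) 1 '' {0}ᶜ = {0}ᶜ := by
    rw [Set.image_compl_eq (EuclideanGeometry.inversion_bijective 0 one_ne_zero)]
    simp
  have hae : ({0}ᶜ : Set (RSpace d)) =ᵐ[volume] Set.univ := by
    rw [eventuallyEq_univ, mem_ae_iff, compl_compl]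
    simp
  rw [himg, setIntegral_congr_set hae, setIntegral_univ] at h
  rw [h, ← setIntegral_univ, ← setIntegral_congr_set hae]
  refine setIntegral_congr_fun (measurableSet_singleton 0).compl fun z hz => ?_
  have hz : z ≠ 0 := hz
  have hnz := norm_pos_iff.mpr hz
  -- The derivative of the inversion is `‖z‖^{-2}` times a reflection, with Jacobian `‖z‖^{-2d}`.
  -- The quadratic form scales by `‖z‖^{-2}`, so its power `-d` in the density contributes
  -- `‖z‖^{2d}` and the factors cancel.
  have hdet : |((1 / dist z 0) ^ 2 • ((ℝ ∙ (z - 0))ᗮ.reflection : RSpace d →L[ℝ] RSpace d)).det| =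
      ((‖z‖ ^ 2) ^ d)⁻¹ := by
    rw [ContinuousLinearMap.det, ContinuousLinearMap.toLinearMap_smul, LinearMap.det_smul,
      finrank_euclideanSpace, Fintype.card_fin, abs_mul]
    have : |LinearMap.det (((ℝ ∙ (z - 0))ᗮ.reflection : RSpace d →L[ℝ] RSpace d) :
        RSpace d →ₗ[ℝ] RSpace d)| = 1 := by
      have h2 := Submodule.det_reflection (𝕜 := ℝ) (E := RSpace d) ((ℝ ∙ (z - 0))ᗮ)
      have h3 : ((((ℝ ∙ (z - 0))ᗮ.reflection : RSpace d →L[ℝ] RSpace d)) :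
          RSpace d →ₗ[ℝ] RSpace d) = (ℝ ∙ (z - 0))ᗮ.reflection.toLinearMap := rfl
      rw [h3, h2, abs_pow, abs_neg, abs_one, one_pow]
    rw [this, mul_one, dist_zero_right, abs_of_pos (by positivity), one_div, inv_pow, inv_pow]
  rw [hdet, hinv, norm_smul, norm_inv, norm_pow, norm_norm]
  have e1 : (‖z‖ ^ 2)⁻¹ * ‖z‖ = ‖z‖⁻¹ := by field_simp
  have e2 : mpcnForm ρ e ((‖z‖ ^ 2)⁻¹ • z) = (‖z‖ ^ 2)⁻¹ * mpcnForm ρ e z := by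
    unfold mpcnForm
    rw [norm_smul, norm_inv, norm_pow, norm_norm, e1, real_inner_smul_right, he]
    field_simp
    ring
  have hf := mpcnForm_pos hρ1 he0 z
  rw [e1, mpcnDensity, mpcnDensity, e2, smul_eq_mul, ← mul_assoc, mul_pow, inv_pow]
  congr 1
  field_simp

/-- Regular variation of the radial weight along a filter gives a drift along that filter. -/
theorem exists_driftRatio_le_of_tendsto_rpow (hd : 0 < d) (hρ0 : 0 < ρ) (hρ1 : ρ < 1)
    (hp : Measurable p) (hp0 : ∀ x, 0 < p x) {l : Filter (RSpace d)} [l.IsCountablyGenerated]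
    (hl : ∀ᶠ x in l, x ≠ 0) {β : ℝ} (hβ : β ≠ 0)
    (h : ∀ z : RSpace d, z ≠ 0 →
      Tendsto (fun x => radialWeight p (‖x‖ • z) / radialWeight p x) l (𝓝 (‖z‖ ^ β))) :
    ∃ r < 1, ∀ᶠ x in l, driftRatio d ρ p x ≤ r := by
  have : Nonempty (Fin d) := ⟨⟨0, hd⟩⟩
  have hw := measurable_radialWeight hp
  have hmr := measurable_mhRate
  have hc := mpcnConst_pos hd hρ1
  have ht0 : ∀ x y : RSpace d, 0 ≤ radialWeight p y / radialWeight p x := fun x y =>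
    div_nonneg (radialWeight_nonneg hp0 y) (radialWeight_nonneg hp0 x)
  have hb0 : ∀ z : RSpace d, 0 ≤ ‖z‖ ^ β := fun z => Real.rpow_nonneg (norm_nonneg z) β
  -- `G(‖z‖)` is the deficit from `2` of the rates at `‖z‖^β` and at its inverse. For `β ≠ 0` it is
  -- positive on `0 < ‖z‖ < 1`, which suffices for a positive integral.
  obtain ⟨G, hG⟩ : ∃ G : ℝ → ℝ, G = fun s => (1 - √(min (s ^ β) (s ^ β)⁻¹)) ^ 2 := ⟨_, rfl⟩
  have hGm : Measurable G := by rw [hG]; fun_prop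
  have hG1 : ∀ z : RSpace d, |G ‖z‖| ≤ 1 := by
    intro z
    have h1 : min (‖z‖ ^ β) (‖z‖ ^ β)⁻¹ ≤ 1 := by
      rcases le_total (‖z‖ ^ β) 1 with h | h
      · exact (min_le_left _ _).trans h
      · exact (min_le_right _ _).trans (inv_le_one_of_one_le₀ h)
    have h2 : √(min (‖z‖ ^ β) (‖z‖ ^ β)⁻¹) ≤ 1 := Real.sqrt_le_one.mpr h1
    have h3 := Real.sqrt_nonneg (min (‖z‖ ^ β) (‖z‖ ^ β)⁻¹)
    rw [hG]
    simp only
    rw [abs_of_nonneg (sq_nonneg _)]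
    nlinarith
  have hG0 : ∀ s, 0 ≤ G s := fun s => by rw [hG]; exact sq_nonneg _
  obtain ⟨δ, hδ⟩ : ∃ δ, δ = mpcnConst d ρ / 2 ^ d * ∫ z : RSpace d, tailWeight z * G ‖z‖ := ⟨_, rfl⟩
  have hδ0 : 0 < δ := by
    rw [hδ]
    refine mul_pos (by positivity) ?_
    rw [integral_pos_iff_support_of_nonneg (fun z => mul_nonneg (tailWeight_pos z).le (hG0 _))
      (integrable_tailWeight_mul hd (by fun_prop) hG1)]
    have hopen : IsOpen {z : RSpace d | 0 < ‖z‖ ∧ ‖z‖ < 1} :=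
      (isOpen_lt continuous_const continuous_norm).inter (isOpen_lt continuous_norm continuous_const)
    have hne : {z : RSpace d | 0 < ‖z‖ ∧ ‖z‖ < 1}.Nonempty := by
      obtain ⟨z, hz⟩ := exists_norm_eq (RSpace d) (c := 1 / 2) (by norm_num)
      exact ⟨z, by simp only [Set.mem_ofPred_eq, hz]; norm_num⟩
    refine (hopen.measure_pos volume hne).trans_le (measure_mono fun z hz => ?_)
    rw [Function.mem_support]
    refine (mul_pos (tailWeight_pos z) ?_).ne'
    have h1 : 0 < ‖z‖ ^ β := Real.rpow_pos_of_pos hz.1 β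
    have h2 : ‖z‖ ^ β ≠ 1 := by
      rcases lt_or_gt_of_ne hβ with hb | hb
      · exact (Real.one_lt_rpow_of_pos_of_lt_one_of_neg hz.1 hz.2 hb).ne'
      · exact (Real.rpow_lt_one hz.1.le hz.2 hb).ne
    have h3 : min (‖z‖ ^ β) (‖z‖ ^ β)⁻¹ < 1 := by
      rcases lt_or_gt_of_ne h2 with h | h
      · exact (min_le_left _ _).trans_lt h
      · exact (min_le_right _ _).trans_lt (inv_lt_one_of_one_lt₀ h)
    have h4 : √(min (‖z‖ ^ β) (‖z‖ ^ β)⁻¹) < 1 := by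
      rw [Real.sqrt_lt' one_pos]; simpa using h3
    rw [hG]
    have : 0 < 1 - √(min (‖z‖ ^ β) (‖z‖ ^ β)⁻¹) := by linarith
    positivity
  have hlimit : ∀ e : RSpace d, ‖e‖ = 1 →
      ∫ z, mpcnDensity d ρ e z * mhRate (‖z‖ ^ β) ≤ 1 - δ / 2 := by
    intro e he
    have he0 : e ≠ 0 := by rintro rfl; simp at he
    have h1 := integral_mpcnDensity_inv_norm hρ1 he (fun s => mhRate (s ^ β))
    have i1 : Integrable fun z => mpcnDensity d ρ e z * mhRate (‖z‖ ^ β) :=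
      integrable_mpcnDensity_mul hd hρ1 he (by fun_prop) fun z => abs_mhRate_le (hb0 z)
    have i2 : Integrable fun z => mpcnDensity d ρ e z * mhRate (‖z‖⁻¹ ^ β) :=
      integrable_mpcnDensity_mul hd hρ1 he (by fun_prop) fun z =>
        abs_mhRate_le (Real.rpow_nonneg (inv_nonneg.mpr (norm_nonneg z)) β)
    have i3 : Integrable fun z => mpcnDensity d ρ e z * G ‖z‖ :=
      integrable_mpcnDensity_mul hd hρ1 he (by fun_prop) hG1
    have i4 := integrable_mpcnDensity hd hρ1 he
    -- By inversion symmetry the two integrals on the left coincide, so this determines twice the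
    -- limiting ratio.
    have hsum : (∫ z, mpcnDensity d ρ e z * mhRate (‖z‖ ^ β)) +
        (∫ z, mpcnDensity d ρ e z * mhRate (‖z‖⁻¹ ^ β)) =
        2 * (∫ z, mpcnDensity d ρ e z) - ∫ z, mpcnDensity d ρ e z * G ‖z‖ := by
      rw [← integral_add i1 i2, ← integral_const_mul, ← integral_sub (i4.const_mul 2) i3]
      refine integral_congr_ae ?_
      have hae : ∀ᵐ z : RSpace d, z ≠ 0 := by
        simp [ae_iff]
      filter_upwards [hae] with z hz
      have := mhRate_add_mhRate_inv (Real.rpow_pos_of_pos (norm_pos_iff.mpr hz) β)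
      rw [← mul_add, Real.inv_rpow (norm_nonneg z), this, hG]
      ring
    have hlow : δ ≤ ∫ z, mpcnDensity d ρ e z * G ‖z‖ := by
      rw [hδ, ← integral_const_mul]
      refine integral_mono ((integrable_tailWeight_mul hd (by fun_prop) hG1).const_mul _) i3
        fun z => ?_
      simp only
      rw [← mul_assoc]
      exact mul_le_mul_of_nonneg_right (le_mpcnDensity hd hρ1 he z) (hG0 _)
    rw [h1, integral_mpcnDensity hd hρ0 hρ1 he0] at hsum
    linarith
  obtain ⟨K, hK⟩ : ∃ K, K = mpcnConst d ρ / (1 - √ρ) ^ d := ⟨_, rfl⟩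
  have hK0 : 0 < K := by
    have : 0 < 1 - √ρ := by have := sqrt_lt_one hρ1; linarith
    rw [hK]; positivity
  have hdiff : ∀ (x z : RSpace d), |mhRate (radialWeight p (‖x‖ • z) / radialWeight p x) -
      mhRate (‖z‖ ^ β)| ≤ 5 / 4 := by
    intro x z
    have h1 := mhRate_nonneg (ht0 x (‖x‖ • z))
    have h2 := mhRate_nonneg (hb0 z)
    have h3 := mhRate_le (ht0 x (‖x‖ • z))
    have h4 := mhRate_le (hb0 z)
    rw [abs_le]; constructor <;> linarith
  have hconv : Tendsto (fun x => ∫ z, tailWeight z *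
      |mhRate (radialWeight p (‖x‖ • z) / radialWeight p x) - mhRate (‖z‖ ^ β)|) l (𝓝 0) := by
    have e0 : (0 : ℝ) = ∫ z : RSpace d, tailWeight z * 0 := by simp
    rw [e0]
    refine tendsto_integral_filter_of_dominated_convergence (fun z => tailWeight z * (5 / 4))
      ?_ ?_ ((integrable_tailWeight hd).mul_const _) ?_
    · refine Eventually.of_forall fun x => ?_
      have := measurable_tailWeight (d := d)
      have hm : Measurable fun z => tailWeight z *
        |mhRate (radialWeight p (‖x‖ • z) / radialWeight p x) - mhRate (‖z‖ ^ β)| := by fun_prop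
      exact hm.aestronglyMeasurable
    · refine Eventually.of_forall fun x => ae_of_all _ fun z => ?_
      rw [Real.norm_of_nonneg (mul_nonneg (tailWeight_pos z).le (abs_nonneg _))]
      exact mul_le_mul_of_nonneg_left (hdiff x z) (tailWeight_pos z).le
    · have hae : ∀ᵐ z : RSpace d, z ≠ 0 := by
        simp [ae_iff]
      filter_upwards [hae] with z hz
      have h1 := (continuousAt_mhRate (Real.rpow_pos_of_pos (norm_pos_iff.mpr hz) β)).tendsto.comp
        (h z hz)
      have h2 := (h1.sub_const (mhRate (‖z‖ ^ β))).abs.const_mul (tailWeight z)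
      simpa using h2
  -- The limiting ratio is at most `1 - δ/2`; the approximation error, bounded through the radial
  -- majorant, uses up `δ/4`.
  refine ⟨1 - δ / 4, by linarith, ?_⟩
  have hev : ∀ᶠ x in l, ∫ z, tailWeight z *
      |mhRate (radialWeight p (‖x‖ • z) / radialWeight p x) - mhRate (‖z‖ ^ β)| < δ / (4 * K) :=
    hconv.eventually_lt_const (by positivity)
  filter_upwards [hev, hl] with x hx hx0
  have he := norm_inv_norm_smul hx0
  have he0 : ‖x‖⁻¹ • x ≠ 0 := by intro h; rw [h] at he; simp at he
  have h1 := hlimit _ he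
  have i1 : Integrable fun z => mpcnDensity d ρ (‖x‖⁻¹ • x) z * mhRate (‖z‖ ^ β) :=
    integrable_mpcnDensity_mul hd hρ1 he (by fun_prop) fun z => abs_mhRate_le (hb0 z)
  have i2 : Integrable fun z => tailWeight z *
      |mhRate (radialWeight p (‖x‖ • z) / radialWeight p x) - mhRate (‖z‖ ^ β)| :=
    integrable_tailWeight_mul hd (by fun_prop) (fun z => by rw [abs_abs]; exact hdiff x z)
  have h2 : driftRatio d ρ p x ≤ ∫ z, (mpcnDensity d ρ (‖x‖⁻¹ • x) z * mhRate (‖z‖ ^ β) +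
      K * (tailWeight z *
        |mhRate (radialWeight p (‖x‖ • z) / radialWeight p x) - mhRate (‖z‖ ^ β)|)) := by
    refine integral_mono (integrable_mpcnDensity_mul hd hρ1 he (by fun_prop)
          fun z => abs_mhRate_le (ht0 _ _)) (i1.add (i2.const_mul K)) fun z => ?_
    simp only
    have h3 := mpcnDensity_le hd hρ1 he z
    rw [← hK] at h3
    have h4 := mpcnDensity_nonneg hd hρ1 he0 z
    have h5 := le_abs_self
      (mhRate (radialWeight p (‖x‖ • z) / radialWeight p x) - mhRate (‖z‖ ^ β))
    have h6 := mul_le_mul_of_nonneg_left h5 h4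
    have h7 := mul_le_mul_of_nonneg_right h3 (abs_nonneg
      (mhRate (radialWeight p (‖x‖ • z) / radialWeight p x) - mhRate (‖z‖ ^ β)))
    linarith
  rw [integral_add i1 (i2.const_mul K), integral_const_mul] at h2
  have h3 := mul_lt_mul_of_pos_left hx hK0
  have h4 : K * (δ / (4 * K)) = δ / 4 := by field_simp
  linarith

end Drift

/-! ### Light tails -/

section LightTails

variable {d : ℕ} {ρ : ℝ} {p : RSpace d → ℝ}

/-- Needed for dominated convergence along `‖x‖ → ∞`. -/
theorem isCountablyGenerated_cobounded : (Bornology.cobounded (RSpace d)).IsCountablyGenerated := by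
  rw [← comap_norm_atTop]
  infer_instance

/-- Indicator of the set of `z` for which the ratio of the radial weights at `‖x‖ z` and at `x` is
in `[η, M]`. -/
noncomputable def ratioWindow (p : RSpace d → ℝ) (η M : ℝ) (x z : RSpace d) : ℝ :=
  {z | η ≤ radialWeight p (‖x‖ • z) / radialWeight p x ∧
    radialWeight p (‖x‖ • z) / radialWeight p x ≤ M}.indicator 1 z

theorem ratioWindow_of_mem {η M : ℝ} {x z : RSpace d}
    (h1 : η ≤ radialWeight p (‖x‖ • z) / radialWeight p x)
    (h2 : radialWeight p (‖x‖ • z) / radialWeight p x ≤ M) : ratioWindow p η M x z = 1 := by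
  unfold ratioWindow
  rw [Set.indicator_of_mem]
  · rfl
  · exact ⟨h1, h2⟩

theorem ratioWindow_nonneg (η M : ℝ) (x z : RSpace d) : 0 ≤ ratioWindow p η M x z :=
  Set.indicator_nonneg (fun _ _ => zero_le_one) _

theorem ratioWindow_le_one (η M : ℝ) (x z : RSpace d) : ratioWindow p η M x z ≤ 1 :=
  Set.indicator_le_self' (f := fun _ => (1 : ℝ)) (fun _ _ => zero_le_one) _

theorem measurable_ratioWindow (hp : Measurable p) (η M : ℝ) (x : RSpace d) :
    Measurable (ratioWindow p η M x) := by
  have hw := measurable_radialWeight hp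
  have h1 : Measurable fun z => radialWeight p (‖x‖ • z) / radialWeight p x := by fun_prop
  exact measurable_one.indicator
    ((measurableSet_le measurable_const h1).inter (measurableSet_le h1 measurable_const))

theorem abs_ratioWindow_le_one (η M : ℝ) (x z : RSpace d) : |ratioWindow p η M x z| ≤ 1 := by
  rw [abs_of_nonneg (ratioWindow_nonneg η M x z)]; exact ratioWindow_le_one η M x z

/-- Dilation by `s` costs the Jacobian `s^d ≤ 2^d`, and the weight only decreases when its argument
is dilated by `s ≥ 1`. -/
theorem integral_ratioWindow_le_scale (hd : 0 < d) (hp : Measurable p) (η M : ℝ) (x : RSpace d)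
    {s : ℝ} (hs1 : 1 ≤ s) (hs2 : s ≤ 2) :
    ∫ z, tailWeight z * ratioWindow p η M x z ≤
      2 ^ d * ∫ z, tailWeight z * ratioWindow p η M x (s • z) := by
  have hm := measurable_ratioWindow hp η M x
  have hs0 : 0 < s := by linarith
  have h := Measure.integral_comp_smul (volume : Measure (RSpace d))
    (fun z => tailWeight z * ratioWindow p η M x z) s
  rw [finrank_euclideanSpace, Fintype.card_fin, smul_eq_mul, abs_of_pos (by positivity),
    eq_inv_mul_iff_mul_eq₀ (by positivity)] at h
  have i1 : Integrable fun z => tailWeight z * ratioWindow p η M x (s • z) :=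
    integrable_tailWeight_mul hd (by fun_prop) fun z => abs_ratioWindow_le_one η M x _
  rw [← h]
  have h0 : 0 ≤ ∫ z, tailWeight z * ratioWindow p η M x (s • z) :=
    integral_nonneg fun z => mul_nonneg (tailWeight_pos z).le (ratioWindow_nonneg _ _ _ _)
  have h1 : ∫ z, tailWeight (s • z) * ratioWindow p η M x (s • z) ≤
      ∫ z, tailWeight z * ratioWindow p η M x (s • z) := by
    refine integral_mono_of_nonneg (ae_of_all _ fun z => mul_nonneg (tailWeight_pos _).le
      (ratioWindow_nonneg _ _ _ _)) i1 (ae_of_all _ fun z => ?_)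
    refine mul_le_mul_of_nonneg_right ?_ (ratioWindow_nonneg _ _ _ _)
    unfold tailWeight
    rw [norm_smul, Real.norm_of_nonneg hs0.le]
    have : ‖z‖ ≤ s * ‖z‖ := le_mul_of_one_le_left (norm_nonneg z) hs1
    gcongr
  calc _ ≤ s ^ d * ∫ z, tailWeight z * ratioWindow p η M x (s • z) :=
        mul_le_mul_of_nonneg_left h1 (by positivity)
    _ ≤ _ := by gcongr

/-- Under rapid variation the ratio of the radial weights stays in a compact subset of `(0, ∞)` only
on a set of vanishing mass. -/
theorem tendsto_integral_ratioWindow (hd : 0 < d) (hp : Measurable p) (hp0 : ∀ x, 0 < p x)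
    (hrv : RapidlyVarying p) {η M : ℝ} (hη : 0 < η) (hM : 0 < M) :
    Tendsto (fun x => ∫ z, tailWeight z * ratioWindow p η M x z)
      (Bornology.cobounded (RSpace d)) (𝓝 0) := by
  have hcg := isCountablyGenerated_cobounded (d := d)
  have : Nonempty (Fin d) := ⟨⟨0, hd⟩⟩
  have hI0 : ∀ x, 0 ≤ ∫ z, tailWeight z * ratioWindow p η M x z := fun x =>
    integral_nonneg fun z => mul_nonneg (tailWeight_pos z).le (ratioWindow_nonneg _ _ _ _)
  have hmT := measurable_tailWeight (d := d)
  have key : ∀ N : ℕ, 0 < N → ∀ᶠ x in Bornology.cobounded (RSpace d),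
      ∫ z, tailWeight z * ratioWindow p η M x z ≤
        2 ^ d / N * ((∫ z : RSpace d, tailWeight z) + 1) := by
    intro N hN
    have hNR : (0 : ℝ) < N := by exact_mod_cast hN
    -- Compare `N` dilates of the window with factors in `[1, 2)`. For each fixed `z ≠ 0` and large
    -- `‖x‖`, at most one of the points `s i • z` falls in the window, so the mass of the window is
    -- of order `1/N`.
    obtain ⟨s, hs⟩ : ∃ s : ℕ → ℝ, s = fun i : ℕ => 1 + (i : ℝ) / N := ⟨_, rfl⟩
    have hs1 : ∀ i, 1 ≤ s i := fun i => by
      rw [hs]; simp only [le_add_iff_nonneg_right]; positivity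
    have hs2 : ∀ i ∈ Finset.range N, s i ≤ 2 := fun i hi => by
      rw [hs]
      have : (i : ℝ) ≤ N := by exact_mod_cast (Finset.mem_range.mp hi).le
      have : (i : ℝ) / N ≤ 1 := (div_le_one hNR).mpr this
      simp only; linarith
    have hsm : ∀ i j, i < j → s i < s j := fun i j hij => by
      have : (i : ℝ) < j := by exact_mod_cast hij
      rw [hs]; simp only; gcongr
    have hs0 : ∀ i, 0 < s i := fun i => by linarith [hs1 i]
    -- Taking the maximum with `1` turns the eventual bound by `1` into an actual pointwise limit,
    -- as dominated convergence requires.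
    obtain ⟨T, hT⟩ : ∃ T : RSpace d → RSpace d → ℝ,
      T = fun x z => max (∑ i ∈ Finset.range N, ratioWindow p η M x (s i • z)) 1 := ⟨_, rfl⟩
    have hsumN : ∀ x z, ∑ i ∈ Finset.range N, ratioWindow p η M x (s i • z) ≤ N := by
      intro x z
      refine (Finset.sum_le_sum fun i _ => ratioWindow_le_one η M x (s i • z)).trans ?_
      simp
    have hTN : ∀ x z, |T x z| ≤ N := by
      intro x z
      have h1 : (1 : ℝ) ≤ N := by exact_mod_cast hN
      rw [hT]
      simp only
      rw [abs_of_nonneg (zero_le_one.trans (le_max_right _ _))]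
      exact max_le (hsumN x z) h1
    have hTm : ∀ x, Measurable (T x) := by
      intro x
      have hm := measurable_ratioWindow hp η M x
      rw [hT]
      refine Measurable.max (Finset.measurable_sum _ fun i _ => ?_) measurable_const
      fun_prop
    have hlim : Tendsto (fun x => ∫ z, tailWeight z * T x z) (Bornology.cobounded (RSpace d))
        (𝓝 (∫ z : RSpace d, tailWeight z * 1)) := by
      refine tendsto_integral_filter_of_dominated_convergence (fun z => tailWeight z * N)
        ?_ ?_ ((integrable_tailWeight hd).mul_const _) ?_
      · exact Eventually.of_forall fun x => (hmT.mul (hTm x)).aestronglyMeasurable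
      · refine Eventually.of_forall fun x => ae_of_all _ fun z => ?_
        rw [norm_mul, Real.norm_of_nonneg (tailWeight_pos z).le]
        exact mul_le_mul_of_nonneg_left (hTN x z) (tailWeight_pos z).le
      · have hae : ∀ᵐ z : RSpace d, z ≠ 0 := by simp [ae_iff]
        filter_upwards [hae] with z hz
        refine Tendsto.congr' (f₁ := fun _ => tailWeight z * 1) ?_ tendsto_const_nhds
        have hpair : ∀ i j, i < j → ∀ᶠ x in Bornology.cobounded (RSpace d),
            radialWeight p (‖x‖ • s j • z) < η / M * radialWeight p (‖x‖ • s i • z) := by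
          intro i j hij
          have hq : 1 < s j / s i := (one_lt_div (hs0 i)).mpr (hsm i j hij)
          have hq0 : 0 < s j / s i := by linarith
          have h1 := ((hrv (s i • z) (smul_ne_zero (hs0 i).ne' hz) (s j / s i) hq0).1 hq).comp
            (tendsto_norm_cobounded_atTop (E := RSpace d))
          -- The factor `(s j / s i)^d` compensates for the growth of `‖·‖^d` in the radial weight.
          -- Only two points on the ray of `z` are compared, so the direction of `x` plays no role.
          have h2 : ∀ᶠ x in Bornology.cobounded (RSpace d),
              p ((‖x‖ * (s j / s i)) • s i • z) / p (‖x‖ • s i • z) <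
                η / M / (s j / s i) ^ d :=
            h1.eventually_lt_const (by positivity)
          have h3 : ∀ᶠ x in Bornology.cobounded (RSpace d), 0 < ‖x‖ :=
            (tendsto_norm_cobounded_atTop (E := RSpace d)).eventually_gt_atTop 0
          filter_upwards [h2, h3] with x hx hx0
          have e1 : (‖x‖ * (s j / s i)) • s i • z = ‖x‖ • s j • z := by
            rw [mul_smul, smul_smul (s j / s i), div_mul_cancel₀ _ (hs0 i).ne']
          rw [e1, div_lt_div_iff₀ (hp0 _) (by positivity)] at hx
          have hnz := norm_pos_iff.mpr hz
          have e2 : ‖‖x‖ • s j • z‖ ^ d = (s j / s i) ^ d * ‖‖x‖ • s i • z‖ ^ d := by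
            rw [← mul_pow]
            congr 1
            rw [norm_smul, norm_smul, norm_smul, norm_smul, norm_norm, Real.norm_of_nonneg (hs0 i).le,
              Real.norm_of_nonneg (hs0 j).le]
            have := (hs0 i).ne'
            field_simp
          have h4 : 0 < ‖‖x‖ • s i • z‖ ^ d := by
            have : ‖x‖ • s i • z ≠ 0 := smul_ne_zero hx0.ne' (smul_ne_zero (hs0 i).ne' hz)
            exact pow_pos (norm_pos_iff.mpr this) d
          unfold radialWeight
          rw [e2, ← mul_assoc, ← mul_assoc]
          exact mul_lt_mul_of_pos_right hx h4
        have hall : ∀ᶠ x in Bornology.cobounded (RSpace d), ∀ i ∈ Finset.range N,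
            ∀ j ∈ Finset.range N, i < j →
            radialWeight p (‖x‖ • s j • z) < η / M * radialWeight p (‖x‖ • s i • z) := by
          rw [Filter.eventually_all_finset]
          intro i _
          rw [Filter.eventually_all_finset]
          intro j _
          by_cases hij : i < j
          · exact (hpair i j hij).mono fun x hx _ => hx
          · exact Eventually.of_forall fun x h => absurd h hij
        have h3 : ∀ᶠ x in Bornology.cobounded (RSpace d), 0 < ‖x‖ :=
          (tendsto_norm_cobounded_atTop (E := RSpace d)).eventually_gt_atTop 0
        filter_upwards [hall, h3] with x hx hx0
        have hwx := radialWeight_pos hp0 (norm_pos_iff.mp hx0)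
        have hle : ∑ i ∈ Finset.range N, ratioWindow p η M x (s i • z) ≤ 1 := by
          classical
          unfold ratioWindow
          simp only [Set.indicator_apply, Pi.one_apply]
          rw [Finset.sum_boole]
          have hno : ∀ i ∈ Finset.range N, ∀ j ∈ Finset.range N, i < j →
              radialWeight p (‖x‖ • s i • z) / radialWeight p x ≤ M →
              η ≤ radialWeight p (‖x‖ • s j • z) / radialWeight p x → False := by
            intro i hi j hj hij h1 h2
            have h4 := hx i hi j hj hij
            rw [div_le_iff₀ hwx] at h1
            rw [le_div_iff₀ hwx] at h2
            have h5 : η / M * radialWeight p (‖x‖ • s i • z) ≤ η / M * (M * radialWeight p x) :=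
              mul_le_mul_of_nonneg_left h1 (by positivity)
            have h6 : η / M * (M * radialWeight p x) = η * radialWeight p x := by
              field_simp
            linarith
          have hcard : (Finset.filter (fun i => s i • z ∈
              {z | η ≤ radialWeight p (‖x‖ • z) / radialWeight p x ∧
                radialWeight p (‖x‖ • z) / radialWeight p x ≤ M}) (Finset.range N)).card ≤ 1 := by
            rw [Finset.card_le_one]
            intro i hi j hj
            rw [Finset.mem_filter] at hi hj
            rcases lt_trichotomy i j with h | h | h
            · exact (hno i hi.1 j hj.1 h hi.2.2 hj.2.1).elim
            · exact h
            · exact (hno j hj.1 i hi.1 h hj.2.2 hi.2.1).elim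
          exact_mod_cast hcard
        rw [hT]
        simp only
        rw [max_eq_right hle]
    have hev := hlim.eventually_lt_const (u := (∫ z : RSpace d, tailWeight z) + 1) (by simp)
    filter_upwards [hev] with x hx
    have hm := measurable_ratioWindow hp η M x
    have h1 : (N : ℝ) * ∫ z, tailWeight z * ratioWindow p η M x z ≤
        2 ^ d * ∫ z, tailWeight z * T x z := by
      calc (N : ℝ) * ∫ z, tailWeight z * ratioWindow p η M x z
          = ∑ i ∈ Finset.range N, ∫ z, tailWeight z * ratioWindow p η M x z := by simp
        _ ≤ ∑ i ∈ Finset.range N, 2 ^ d * ∫ z, tailWeight z * ratioWindow p η M x (s i • z) :=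
            Finset.sum_le_sum fun i hi =>
              integral_ratioWindow_le_scale hd hp η M x (hs1 i) (hs2 i hi)
        _ = 2 ^ d * ∫ z, tailWeight z *
              ∑ i ∈ Finset.range N, ratioWindow p η M x (s i • z) := by
            rw [← Finset.mul_sum, ← integral_finsetSum]
            · simp only [Finset.mul_sum]
            · intro i _
              exact integrable_tailWeight_mul hd (by fun_prop)
                fun z => abs_ratioWindow_le_one η M x _
        _ ≤ _ := by
            refine mul_le_mul_of_nonneg_left ?_ (by positivity)
            refine integral_mono (integrable_tailWeight_mul hd (C := N) ?_ ?_)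
              (integrable_tailWeight_mul hd (hTm x) (hTN x)) fun z => ?_
            · refine Finset.measurable_sum _ fun i _ => ?_
              fun_prop
            · intro z
              rw [abs_of_nonneg (Finset.sum_nonneg fun i _ => ratioWindow_nonneg _ _ _ _)]
              exact hsumN x z
            · refine mul_le_mul_of_nonneg_left ?_ (tailWeight_pos z).le
              rw [hT]; exact le_max_left _ _
    rw [div_mul_eq_mul_div, le_div_iff₀ hNR, mul_comm]
    refine h1.trans (mul_le_mul_of_nonneg_left hx.le (by positivity))
  rw [Metric.tendsto_nhds]
  intro ε hε
  obtain ⟨B, hB⟩ : ∃ B, B = 2 ^ d * ((∫ z : RSpace d, tailWeight z) + 1) := ⟨_, rfl⟩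
  obtain ⟨N, hN⟩ := exists_nat_gt (max (B / ε) 1)
  have hN1 : (1 : ℝ) < N := (le_max_right _ _).trans_lt hN
  have hN0 : 0 < N := by exact_mod_cast (zero_lt_one.trans hN1)
  have hNB : B / ε < N := (le_max_left _ _).trans_lt hN
  filter_upwards [key N hN0] with x hx
  rw [dist_zero_right, Real.norm_of_nonneg (hI0 x)]
  refine hx.trans_lt ?_
  rw [div_mul_eq_mul_div, ← hB, div_lt_iff₀ (by linarith)]
  rw [div_lt_iff₀ hε] at hNB
  linarith

/-- The curvature condition provides a ball of proposals, at unit scale, on which the target density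
is at least its value at the current state. -/
theorem exists_ball_of_curvature (hp0 : ∀ x, 0 < p x) (hdiff : Differentiable ℝ p)
    (hcurv : CurvatureCondition p) :
    ∃ κ > 0, ∀ᶠ x in Bornology.cobounded (RSpace d), ∃ z0 : RSpace d, ∀ z ∈ Metric.ball z0 κ,
      1 / 2 ≤ ‖z‖ ∧ ‖z‖ ≤ 2 ∧ p x ≤ p (‖x‖ • z) := by
  obtain ⟨b, hb1, hb0⟩ := exists_between hcurv
  -- `δ` is the gap in the curvature condition; the cap at `1` keeps the segments used below in the
  -- annulus `1/2 ≤ ‖u‖ ≤ 2`.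
  obtain ⟨δ, hδ⟩ : ∃ δ, δ = min (-b) 1 := ⟨_, rfl⟩
  have hδ0 : 0 < δ := by rw [hδ]; exact lt_min (by linarith) one_pos
  have hδ1 : δ ≤ 1 := by rw [hδ]; exact min_le_right _ _
  have hδb : b ≤ -δ := by rw [hδ]; linarith [min_le_left (-b) 1]
  have hev := eventually_lt_of_limsup_lt hb1 (by
    refine ⟨1, eventually_map.mpr (Eventually.of_forall fun x => ?_)⟩
    refine (real_inner_le_norm _ _).trans ?_
    rw [norm_smul, norm_smul, norm_inv, norm_inv, norm_norm, norm_norm]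
    exact mul_le_one₀ inv_mul_le_one (by positivity) inv_mul_le_one)
  have hgrad : ∀ᶠ y in Bornology.cobounded (RSpace d),
      inner ℝ (gradient (fun y => Real.log (p y)) y) y ≤
        -(δ * (‖gradient (fun y => Real.log (p y)) y‖ * ‖y‖)) := by
    filter_upwards [hev] with y hy
    obtain ⟨g, hg⟩ : ∃ g, g = gradient (fun y => Real.log (p y)) y := ⟨_, rfl⟩
    rw [← hg] at hy ⊢
    rcases eq_or_ne g 0 with h | h
    · simp [h]
    rcases eq_or_ne y 0 with h' | h'
    · simp [h']
    have h1 := norm_pos_iff.mpr h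
    have h2 := norm_pos_iff.mpr h'
    rw [real_inner_smul_left, real_inner_smul_right] at hy
    have h3 : ‖y‖⁻¹ * (‖g‖⁻¹ * inner ℝ y g) ≤ -δ := by linarith
    rw [← mul_assoc, ← mul_inv, inv_mul_le_iff₀ (by positivity)] at h3
    rw [real_inner_comm]
    linarith
  rw [← comap_norm_atTop, eventually_comap, eventually_atTop] at hgrad
  obtain ⟨R, hR⟩ := hgrad
  have hlog : Differentiable ℝ fun y => Real.log (p y) := fun y =>
    (hdiff y).log (hp0 y).ne'
  refine ⟨δ / 8, by positivity, ?_⟩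
  -- All points of the segments have norm at least `‖x‖/2 ≥ R`, so the gradient bound holds along
  -- them.
  have hlarge : ∀ᶠ x in Bornology.cobounded (RSpace d), max (2 * R) 1 ≤ ‖x‖ :=
    (tendsto_norm_cobounded_atTop (E := RSpace d)).eventually_ge_atTop _
  filter_upwards [hlarge] with x hx
  have hx1 : 1 ≤ ‖x‖ := (le_max_right _ _).trans hx
  have hxR : 2 * R ≤ ‖x‖ := (le_max_left _ _).trans hx
  have hx0 : x ≠ 0 := by rintro rfl; simp at hx1; linarith
  obtain ⟨e, he⟩ : ∃ e, e = ‖x‖⁻¹ • x := ⟨_, rfl⟩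
  have he1 : ‖e‖ = 1 := by rw [he]; exact norm_inv_norm_smul hx0
  have hxe : x = ‖x‖ • e := by rw [he, smul_inv_smul₀ (by positivity)]
  refine ⟨(3 / 4 : ℝ) • e, fun z hz => ?_⟩
  obtain ⟨v, hv⟩ : ∃ v, v = z - (3 / 4 : ℝ) • e := ⟨_, rfl⟩
  have hvn : ‖v‖ < δ / 8 := by rw [hv]; simpa [dist_eq_norm] using hz
  have hseg : ∀ s : ℝ, 0 ≤ s → s ≤ 1 → 1 / 2 ≤ ‖(1 - s / 4) • e + s • v‖ ∧
      ‖(1 - s / 4) • e + s • v‖ ≤ 2 := by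
    intro s hs0 hs1
    have h1 : ‖(1 - s / 4) • e‖ = 1 - s / 4 := by
      rw [norm_smul, he1, mul_one, Real.norm_of_nonneg (by linarith)]
    have h2 : ‖s • v‖ ≤ 1 / 8 := by
      rw [norm_smul, Real.norm_of_nonneg hs0]
      nlinarith [norm_nonneg v]
    have h3 := norm_sub_norm_le ((1 - s / 4) • e) (-(s • v))
    rw [sub_neg_eq_add, norm_neg] at h3
    have h4 := norm_add_le ((1 - s / 4) • e) (s • v)
    constructor <;> linarith
  have hz1 : z = (1 - (1 : ℝ) / 4) • e + (1 : ℝ) • v := by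
    rw [hv]; module
  have hbd := hseg 1 zero_le_one le_rfl
  rw [← hz1] at hbd
  refine ⟨hbd.1, hbd.2, ?_⟩
  -- The segment from `x` to `‖x‖ z`; `log p` turns out to be nondecreasing along it.
  obtain ⟨c, hc⟩ : ∃ c : ℝ → RSpace d, c = fun s => ‖x‖ • ((1 - s / 4) • e + s • v) := ⟨_, rfl⟩
  have hcd : ∀ s, HasDerivAt c (‖x‖ • ((-(1 / 4) : ℝ) • e + (1 : ℝ) • v)) s := by
    intro s
    rw [hc]
    have h1 : HasDerivAt (fun s : ℝ => 1 - s / 4) (-(1 / 4)) s := by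
      simpa using ((hasDerivAt_id s).div_const 4).const_sub 1
    exact ((h1.smul_const e).add ((hasDerivAt_id s).smul_const v)).const_smul ‖x‖
  have hderiv : ∀ s, HasDerivAt (fun s => Real.log (p (c s)))
      (inner ℝ (gradient (fun y => Real.log (p y)) (c s))
        (‖x‖ • ((-(1 / 4) : ℝ) • e + (1 : ℝ) • v))) s := by
    intro s
    have h1 : HasDerivAt (fun s => Real.log (p (c s)))
        (InnerProductSpace.toDual ℝ (RSpace d) (gradient (fun y => Real.log (p y)) (c s))
          (‖x‖ • ((-(1 / 4) : ℝ) • e + (1 : ℝ) • v))) s :=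
      (hlog (c s)).hasGradientAt.hasFDerivAt.comp_hasDerivAt s (hcd s)
    rwa [InnerProductSpace.toDual_apply_apply] at h1
  have hmono : MonotoneOn (fun s => Real.log (p (c s))) (Set.Icc 0 1) := by
    refine monotoneOn_of_deriv_nonneg (convex_Icc 0 1)
      (fun s _ => (hderiv s).continuousAt.continuousWithinAt)
      (fun s _ => (hderiv s).differentiableAt.differentiableWithinAt) fun s hs => ?_
    rw [interior_Icc] at hs
    rw [(hderiv s).deriv]
    obtain ⟨u, hu⟩ : ∃ u, u = (1 - s / 4) • e + s • v := ⟨_, rfl⟩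
    have hub := hseg s hs.1.le hs.2.le
    rw [← hu] at hub
    have hcs : c s = ‖x‖ • u := by rw [hc, hu]
    have hcn : ‖c s‖ = ‖x‖ * ‖u‖ := by rw [hcs, norm_smul, norm_norm]
    have hg := hR ‖c s‖ (by rw [hcn]; nlinarith) (c s) rfl
    obtain ⟨g, hg'⟩ : ∃ g, g = gradient (fun y => Real.log (p y)) (c s) := ⟨_, rfl⟩
    rw [← hg'] at hg ⊢
    rw [hcn, hcs, real_inner_smul_right] at hg
    have hgu : inner ℝ g u ≤ -(δ * (‖g‖ * ‖u‖)) := by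
      have : ‖x‖ * inner ℝ g u ≤ ‖x‖ * -(δ * (‖g‖ * ‖u‖)) := by linarith
      exact le_of_mul_le_mul_left this (by linarith)
    have hgv : -(‖g‖ * (δ / 8)) ≤ inner ℝ g v := by
      have h1 := (abs_le.mp (abs_real_inner_le_norm g v)).1
      have h2 := mul_le_mul_of_nonneg_left hvn.le (norm_nonneg g)
      linarith
    rw [real_inner_smul_right]
    refine mul_nonneg (norm_nonneg x) ?_
    have hs4 : 0 < 1 - s / 4 := by linarith [hs.2]
    -- Up to a positive factor, the velocity is `-u/4 + v` with `u` the rescaled current point. The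
    -- radial part gains at least `δ‖g‖‖u‖/4 ≥ δ‖g‖/8`, and `v` loses at most `δ‖g‖/8`: hence the
    -- radius `δ/8`.
    have e1 : (1 - s / 4) • ((-(1 / 4) : ℝ) • e + (1 : ℝ) • v) = (-(1 / 4) : ℝ) • u + v := by
      rw [hu]; module
    have e2 : (1 - s / 4) * inner ℝ g ((-(1 / 4) : ℝ) • e + (1 : ℝ) • v) =
        -(1 / 4) * inner ℝ g u + inner ℝ g v := by
      rw [← real_inner_smul_right, e1, inner_add_right, real_inner_smul_right]
    have h5 : 0 ≤ (1 - s / 4) * inner ℝ g ((-(1 / 4) : ℝ) • e + (1 : ℝ) • v) := by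
      rw [e2]
      have h6 : ‖g‖ * δ * (1 / 2) ≤ ‖g‖ * δ * ‖u‖ :=
        mul_le_mul_of_nonneg_left hub.1 (by positivity)
      nlinarith
    exact nonneg_of_mul_nonneg_right h5 hs4
  have h01 := hmono (Set.left_mem_Icc.mpr zero_le_one) (Set.right_mem_Icc.mpr zero_le_one)
    zero_le_one
  have hc0 : c 0 = x := by rw [hc]; simp [← hxe]
  have hc1 : c 1 = ‖x‖ • z := by rw [hc, hz1]
  simp only [hc0, hc1] at h01
  exact (Real.log_le_log_iff (hp0 _) (hp0 _)).mp h01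

/-- Drift at infinity for rapidly varying targets with an acceptance ball. -/
theorem exists_driftRatio_le_of_rapidlyVarying (hd : 0 < d) (hρ0 : 0 < ρ) (hρ1 : ρ < 1)
    (hp : Measurable p) (hp0 : ∀ x, 0 < p x) (hrv : RapidlyVarying p) {κ : ℝ} (hκ : 0 < κ)
    (hball : ∀ᶠ x in Bornology.cobounded (RSpace d), ∃ z0 : RSpace d, ∀ z ∈ Metric.ball z0 κ,
      1 / 2 ≤ ‖z‖ ∧ ‖z‖ ≤ 2 ∧ p x ≤ p (‖x‖ • z)) :
    ∃ r < 1, ∀ᶠ x in Bornology.cobounded (RSpace d), driftRatio d ρ p x ≤ r := by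
  have hc := mpcnConst_pos hd hρ1
  have hmr := measurable_mhRate
  have hw := measurable_radialWeight hp
  -- A lower bound for the proposal mass of the acceptance ball, uniform in its center and in the
  -- direction of `x`; the factor `5^{-d}` comes from `‖z‖ ≤ 2`.
  obtain ⟨m, hm⟩ : ∃ m, m = mpcnConst d ρ / 2 ^ d *
    (((5 : ℝ) ^ d)⁻¹ * volume.real (Metric.ball (0 : RSpace d) κ)) := ⟨_, rfl⟩
  have hm0 : 0 < m := by
    have : 0 < volume.real (Metric.ball (0 : RSpace d) κ) :=
      ENNReal.toReal_pos (Metric.measure_ball_pos volume 0 hκ).ne' measure_ball_lt_top.ne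
    rw [hm]; positivity
  -- The first bound places the ratio on the acceptance ball above `η`, as `‖z‖ ≥ 1/2` there; the
  -- second makes the excess `√η` at most `m/8`.
  obtain ⟨η, hη⟩ : ∃ η : ℝ, η = min ((1 / 2) ^ d) ((m / 8) ^ 2) := ⟨_, rfl⟩
  have hη0 : 0 < η := by rw [hη]; exact lt_min (by positivity) (by positivity)
  have hη1 : η ≤ (1 / 2) ^ d := by rw [hη]; exact min_le_left _ _
  have hηm : √η ≤ m / 8 := by
    rw [Real.sqrt_le_left (by positivity), hη]; exact min_le_right _ _
  obtain ⟨K, hK⟩ : ∃ K, K = mpcnConst d ρ / (1 - √ρ) ^ d := ⟨_, rfl⟩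
  have hK0 : 0 < K := by
    have : 0 < 1 - √ρ := by have := sqrt_lt_one hρ1; linarith
    rw [hK]; positivity
  have hwin := (tendsto_integral_ratioWindow hd hp hp0 hrv hη0 (M := 4) (by norm_num)).eventually_lt_const
    (u := m / (10 * K)) (by positivity)
  have h3 : ∀ᶠ x in Bornology.cobounded (RSpace d), 0 < ‖x‖ :=
    (tendsto_norm_cobounded_atTop (E := RSpace d)).eventually_gt_atTop 0
  refine ⟨1 - m / 4, by linarith, ?_⟩
  filter_upwards [hwin, hball, h3] with x hxw hxb hnx
  obtain ⟨z0, hz0⟩ := hxb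
  have hx0 := norm_pos_iff.mp hnx
  have hwx := radialWeight_pos hp0 hx0
  have he := norm_inv_norm_smul hx0
  have he0 : ‖x‖⁻¹ • x ≠ 0 := by intro h; rw [h] at he; simp at he
  have ht0 : ∀ y : RSpace d, 0 ≤ radialWeight p y / radialWeight p x := fun y =>
    div_nonneg (radialWeight_nonneg hp0 y) hwx.le
  have hWm := measurable_ratioWindow hp η 4 x
  obtain ⟨χ, hχ⟩ : ∃ χ : RSpace d → ℝ, χ = (Metric.ball z0 κ).indicator 1 := ⟨_, rfl⟩
  have hχm : Measurable χ := by rw [hχ]; exact measurable_one.indicator measurableSet_ball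
  have hχ0 : ∀ z, 0 ≤ χ z := fun z => by
    rw [hχ]; exact Set.indicator_nonneg (fun _ _ => zero_le_one) _
  have hχ1 : ∀ z, |χ z| ≤ 1 := fun z => by
    rw [abs_of_nonneg (hχ0 z), hχ]
    exact Set.indicator_le_self' (f := fun _ => (1 : ℝ)) (fun _ _ => zero_le_one) _
  -- Three regimes: ratios below `η` give at most `1 + √η` and do not occur on the ball; ratios in
  -- `[η, 4]` give at most `5/4` and are paid for by the window; ratios above `4` give at most
  -- `1/2`. Integration yields `1 + m/8 + (5/4)(m/10) - m/2 = 1 - m/4`.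
  have hpt : ∀ z, mhRate (radialWeight p (‖x‖ • z) / radialWeight p x) ≤
      (1 + √η) + 5 / 4 * ratioWindow p η 4 x z - 1 / 2 * χ z := by
    intro z
    obtain ⟨t, ht⟩ : ∃ t, t = radialWeight p (‖x‖ • z) / radialWeight p x := ⟨_, rfl⟩
    have htn : 0 ≤ t := by rw [ht]; exact ht0 _
    have hsη := Real.sqrt_nonneg η
    have hχz := (abs_le.mp (hχ1 z)).2
    have hWz := ratioWindow_nonneg (p := p) η 4 x z
    have hηt : z ∈ Metric.ball z0 κ → η ≤ t := by
      intro hz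
      obtain ⟨hz1, _, hz3⟩ := hz0 z hz
      rw [ht, le_div_iff₀ hwx]
      unfold radialWeight
      rw [norm_smul, norm_norm, mul_pow]
      have h1 : η ≤ ‖z‖ ^ d := hη1.trans (by gcongr)
      have h2 : p x * ‖x‖ ^ d * η ≤ p (‖x‖ • z) * ‖x‖ ^ d * ‖z‖ ^ d := by
        have := hp0 x
        have := hp0 (‖x‖ • z)
        gcongr
      linarith
    rw [← ht]
    by_cases h1 : η ≤ t
    · by_cases h2 : t ≤ 4
      · have h4 : ratioWindow p η 4 x z = 1 := ratioWindow_of_mem (ht ▸ h1) (ht ▸ h2)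
        have := mhRate_le htn
        rw [h4]; linarith
      · have := mhRate_le_half (not_le.mp h2).le
        linarith
    · have h4 : χ z = 0 := by
        rw [hχ]; exact Set.indicator_of_notMem (fun h => h1 (hηt h)) _
      have h5 := mhRate_le_one_add_sqrt htn
      have h6 := Real.sqrt_le_sqrt (not_le.mp h1).le
      rw [h4]; linarith
  obtain ⟨k, hk⟩ : ∃ k, k = mpcnDensity d ρ (‖x‖⁻¹ • x) := ⟨_, rfl⟩
  have hk0 : ∀ z, 0 ≤ k z := fun z => by rw [hk]; exact mpcnDensity_nonneg hd hρ1 he0 z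
  have ik : Integrable k := by rw [hk]; exact integrable_mpcnDensity hd hρ1 he
  have iW : Integrable fun z => k z * ratioWindow p η 4 x z := by
    rw [hk]; exact integrable_mpcnDensity_mul hd hρ1 he hWm (abs_ratioWindow_le_one η 4 x)
  have iχ : Integrable fun z => k z * χ z := by
    rw [hk]; exact integrable_mpcnDensity_mul hd hρ1 he hχm hχ1
  have iT : Integrable fun z => tailWeight z * ratioWindow p η 4 x z :=
    integrable_tailWeight_mul hd hWm (abs_ratioWindow_le_one η 4 x)
  have hmain : driftRatio d ρ p x ≤ (1 + √η) * (∫ z, k z) +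
      5 / 4 * (∫ z, k z * ratioWindow p η 4 x z) - 1 / 2 * (∫ z, k z * χ z) := by
    have i5 : Integrable fun z => (1 + √η) * k z + 5 / 4 * (k z * ratioWindow p η 4 x z) :=
      (ik.const_mul _).add (iW.const_mul _)
    rw [← integral_const_mul, ← integral_const_mul, ← integral_const_mul,
      ← integral_add (ik.const_mul _) (iW.const_mul _), ← integral_sub i5 (iχ.const_mul _),
      driftRatio, ← hk]
    refine integral_mono ?_ (i5.sub (iχ.const_mul _)) fun z => ?_
    · rw [hk]
      exact integrable_mpcnDensity_mul hd hρ1 he (by fun_prop) fun z => abs_mhRate_le (ht0 _)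
    · have := mul_le_mul_of_nonneg_left (hpt z) (hk0 z)
      simp only
      linarith
  have hone : ∫ z, k z = 1 := by rw [hk]; exact integral_mpcnDensity hd hρ0 hρ1 he0
  have hW : ∫ z, k z * ratioWindow p η 4 x z ≤ K * ∫ z, tailWeight z * ratioWindow p η 4 x z := by
    rw [← integral_const_mul]
    refine integral_mono iW (iT.const_mul _) fun z => ?_
    have h1 : k z ≤ K * tailWeight z := by rw [hk, hK]; exact mpcnDensity_le hd hρ1 he z
    have := mul_le_mul_of_nonneg_right h1 (ratioWindow_nonneg (p := p) η 4 x z)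
    simp only
    linarith
  have hχlow : m ≤ ∫ z, k z * χ z := by
    have e1 : m = ∫ z, mpcnConst d ρ / 2 ^ d * ((5 : ℝ) ^ d)⁻¹ * χ z := by
      rw [integral_const_mul, hχ, integral_indicator_one measurableSet_ball, hm, mul_assoc,
        Measure.real, Measure.real, Measure.addHaar_ball_center volume z0]
    rw [e1]
    refine integral_mono_of_nonneg (ae_of_all _ fun z => ?_) iχ (ae_of_all _ fun z => ?_)
    · exact mul_nonneg (by positivity) (hχ0 z)
    · by_cases hz : z ∈ Metric.ball z0 κ
      · refine mul_le_mul_of_nonneg_right ?_ (hχ0 z)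
        have hkz : mpcnConst d ρ / 2 ^ d * tailWeight z ≤ k z := by
          rw [hk]; exact le_mpcnDensity hd hρ1 he z
        refine le_trans ?_ hkz
        refine mul_le_mul_of_nonneg_left ?_ (by positivity)
        unfold tailWeight
        have h2 := (hz0 z hz).2.1
        have h4 : 1 + ‖z‖ ^ 2 ≤ 5 := by nlinarith [norm_nonneg z]
        gcongr
      · have : χ z = 0 := by rw [hχ]; exact Set.indicator_of_notMem hz _
        simp [this]
  have hKm : K * (m / (10 * K)) = m / 10 := by field_simp
  have hlt := mul_lt_mul_of_pos_left hxw hK0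
  rw [hone] at hmain
  linarith

end LightTails

/-! ### Invariance, minorization and decay of the radial weight -/

section Assembly

variable {d : ℕ} {ρ : ℝ} {p : RSpace d → ℝ}

instance isMarkovKernel_mpcnKernel (hp : Measurable p) : IsMarkovKernel (mpcnKernel d ρ p hp) := by
  unfold mpcnKernel; infer_instance

theorem ae_ne_zero (hd : 0 < d) : ∀ᵐ x : RSpace d, x ≠ 0 := by
  have : Nonempty (Fin d) := ⟨⟨0, hd⟩⟩
  simp [ae_iff]

/-- The flow density `p(x) q(x,y) a(x,y)` equals a constant times `min(w(x), w(y))` over the `d`-th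
power of the symmetric quadratic form, with `w` the radial weight. Detailed balance follows. -/
theorem mpcnKernel_invariant (hd : 0 < d) (hρ0 : 0 < ρ) (hρ1 : ρ < 1) (hp : Measurable p)
    (hp0 : ∀ x, 0 < p x) : (mpcnKernel d ρ p hp).Invariant (targetMeasure p) := by
  refine Kernel.IsReversible.invariant ?_
  unfold mpcnKernel targetMeasure
  refine mhKernel_isReversible (q := fun x y => ENNReal.ofReal (mpcnDensity d ρ x y))
    (measurable_mpcnDensity d ρ).ennreal_ofReal ?_ hp.ennreal_ofReal ?_
  · filter_upwards [ae_ne_zero hd] with x hx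
    exact mpcnProposal_eq_withDensity hρ0 hρ1 hx
  · filter_upwards [ae_ne_zero hd] with x hx
    filter_upwards [ae_ne_zero hd] with y hy
    have key : ∀ x y : RSpace d, x ≠ 0 → y ≠ 0 →
        ENNReal.ofReal (p x) * (ENNReal.ofReal (mpcnDensity d ρ x y) *
          acceptProb p (fun x => (‖x‖ ^ d)⁻¹) x y) =
        ENNReal.ofReal (mpcnConst d ρ / mpcnForm ρ x y ^ d *
          min (radialWeight p x) (radialWeight p y)) := by
      intro x y hx hy
      have hwx := radialWeight_pos hp0 hx
      rw [acceptProb_eq_radialWeight, ← ENNReal.ofReal_mul (mpcnDensity_nonneg hd hρ1 hx y),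
        ← ENNReal.ofReal_mul (hp0 x).le]
      congr 1
      have e : min (radialWeight p x) (radialWeight p y) =
          radialWeight p x * min 1 (radialWeight p y / radialWeight p x) := by
        rw [mul_min_of_nonneg _ _ hwx.le, mul_one, mul_div_cancel₀ _ hwx.ne']
      rw [e, mpcnDensity]
      generalize min 1 (radialWeight p y / radialWeight p x) = a
      rw [radialWeight]
      ring
    rw [key x y hx hy, key y x hy hx, mpcnForm_comm, min_comm]

/-- The MpCN kernel minorizes on annuli. -/
theorem exists_minorization_annulus (hd : 0 < d) (hρ0 : 0 < ρ) (hρ1 : ρ < 1) (hp : Measurable p)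
    (hp0 : ∀ x, 0 < p x) (hcont : Continuous p) {a b : ℝ} (ha : 0 < a) (hab : a < b) :
    ∃ ν : Measure (RSpace d), ν ≠ 0 ∧
      ∀ x, a ≤ ‖x‖ → ‖x‖ ≤ b → ν ≤ mpcnKernel d ρ p hp x := by
  have : Nonempty (Fin d) := ⟨⟨0, hd⟩⟩
  have hb : 0 < b := ha.trans hab
  have hcpt : IsCompact (Metric.closedBall (0 : RSpace d) b) := isCompact_closedBall 0 b
  have hne : (Metric.closedBall (0 : RSpace d) b).Nonempty := ⟨0, by simp [hb.le]⟩
  obtain ⟨x1, -, hx1⟩ := hcpt.exists_isMinOn hne hcont.continuousOn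
  obtain ⟨x2, -, hx2⟩ := hcpt.exists_isMaxOn hne hcont.continuousOn
  have hc := mpcnConst_pos hd hρ1
  have h1 := hp0 x1
  have h2 := hp0 x2
  -- The product of lower bounds on the annulus for the proposal density and for the acceptance
  -- probability, with `p x1` and `p x2` the extreme values of `p` on the closed ball.
  obtain ⟨ε, hε⟩ : ∃ ε, ε = mpcnConst d ρ * a ^ d / (2 * (b ^ 2 + b ^ 2)) ^ d *
    min 1 (p x1 * a ^ d / (p x2 * b ^ d)) := ⟨_, rfl⟩
  have hε0 : 0 < ε := by
    rw [hε]
    have : 0 < min 1 (p x1 * a ^ d / (p x2 * b ^ d)) := lt_min one_pos (by positivity)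
    positivity
  obtain ⟨A, hA⟩ : ∃ A : Set (RSpace d), A = {x | a ≤ ‖x‖ ∧ ‖x‖ ≤ b} := ⟨_, rfl⟩
  have hAm : MeasurableSet A := by
    rw [hA]
    exact (measurableSet_le measurable_const measurable_norm).inter
      (measurableSet_le measurable_norm measurable_const)
  have hApos : 0 < volume A := by
    have hopen : IsOpen {z : RSpace d | a < ‖z‖ ∧ ‖z‖ < b} :=
      (isOpen_lt continuous_const continuous_norm).inter (isOpen_lt continuous_norm continuous_const)
    obtain ⟨z, hz⟩ := exists_norm_eq (RSpace d) (c := (a + b) / 2) (by positivity)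
    have hne : {z : RSpace d | a < ‖z‖ ∧ ‖z‖ < b}.Nonempty :=
      ⟨z, by constructor <;> rw [hz] <;> linarith⟩
    refine (hopen.measure_pos volume hne).trans_le (measure_mono fun z hz => ?_)
    rw [hA]
    exact ⟨hz.1.le, hz.2.le⟩
  refine ⟨ENNReal.ofReal ε • volume.restrict A, ?_, fun x hxa hxb => ?_⟩
  · intro h
    have h3 := congrArg (fun μ => μ Set.univ) h
    simp only [Measure.smul_apply, Measure.restrict_apply_univ, smul_eq_mul, Measure.coe_zero,
      Pi.zero_apply, mul_eq_zero, ENNReal.ofReal_eq_zero] at h3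
    rcases h3 with h3 | h3
    · linarith
    · exact hApos.ne' h3
  · have hnx : 0 < ‖x‖ := ha.trans_le hxa
    have hx0 := norm_pos_iff.mp hnx
    rw [Measure.le_iff]
    intro B hB
    rw [Measure.smul_apply, smul_eq_mul, Measure.restrict_apply hB]
    unfold mpcnKernel
    rw [mhKernel_apply, Measure.add_apply]
    refine le_trans ?_ le_self_add
    rw [withDensity_apply _ hB, mpcnProposal_eq_withDensity hρ0 hρ1 hx0,
      setLIntegral_withDensity_eq_setLIntegral_mul _
        (measurable_mpcnDensity_right x).ennreal_ofReal
        (measurable_acceptProb_right hp (by fun_prop) x) hB]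
    calc ENNReal.ofReal ε * volume (B ∩ A) = ∫⁻ _ in B ∩ A, ENNReal.ofReal ε := by simp
      _ ≤ ∫⁻ y in B ∩ A, ((fun y => ENNReal.ofReal (mpcnDensity d ρ x y)) *
            acceptProb p (fun x => (‖x‖ ^ d)⁻¹) x) y := by
          refine setLIntegral_mono' (hB.inter hAm) fun y hy => ?_
          have hyA := hy.2
          rw [hA] at hyA
          obtain ⟨hya, hyb⟩ := hyA
          rw [Pi.mul_apply, acceptProb_eq_radialWeight,
            ← ENNReal.ofReal_mul (mpcnDensity_nonneg hd hρ1 hx0 y)]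
          refine ENNReal.ofReal_le_ofReal ?_
          rw [hε]
          have hform := mpcnForm_pos hρ1 hx0 y
          have hformle : mpcnForm ρ x y ≤ 2 * (b ^ 2 + b ^ 2) :=
            (mpcnForm_le hρ1 x y).trans (by gcongr)
          have hpx : p x ≤ p x2 := hx2 (by simpa using hxb)
          have hpy : p x1 ≤ p y := hx1 (by simpa using hyb)
          have hpx0 := hp0 x
          have hpy0 := hp0 y
          have h4 : p x1 * a ^ d / (p x2 * b ^ d) ≤ radialWeight p y / radialWeight p x := by
            unfold radialWeight
            gcongr
          have h5 : mpcnConst d ρ * a ^ d / (2 * (b ^ 2 + b ^ 2)) ^ d ≤ mpcnDensity d ρ x y := by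
            unfold mpcnDensity
            gcongr
          exact mul_le_mul h5 (min_le_min_left 1 h4) (le_min zero_le_one (by positivity))
            (mpcnDensity_nonneg hd hρ1 hx0 y)
      _ ≤ _ := lintegral_mono_set Set.inter_subset_left

/-- The radial weight of an integrable density vanishes at infinity as soon as the density is
comparable to `p x` on a ball of radius proportional to `‖x‖`. -/
theorem tendsto_radialWeight_cobounded (hd : 0 < d) (hp0 : ∀ x, 0 < p x)
    [IsProbabilityMeasure (targetMeasure p)] {c κ : ℝ} (hc : 0 < c) (hκ : 0 < κ)
    (hball : ∀ᶠ x in Bornology.cobounded (RSpace d), ∃ z0 : RSpace d, ∀ z ∈ Metric.ball z0 κ,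
      1 / 2 ≤ ‖z‖ ∧ c * p x ≤ p (‖x‖ • z)) :
    Tendsto (radialWeight p) (Bornology.cobounded (RSpace d)) (𝓝 0) := by
  have : Nonempty (Fin d) := ⟨⟨0, hd⟩⟩
  have htail : Tendsto (fun r : ℝ => (targetMeasure p).real {y | r ≤ ‖y‖}) atTop (𝓝 0) := by
    have h := tendsto_measure_iInter_atTop (μ := targetMeasure p)
      (s := fun r : ℝ => {y : RSpace d | r ≤ ‖y‖})
      (fun r => (measurableSet_le measurable_const measurable_norm).nullMeasurableSet)
      (fun r s hrs y hy => hrs.trans hy) ⟨0, measure_ne_top _ _⟩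
    have hempty : ⋂ r : ℝ, {y : RSpace d | r ≤ ‖y‖} = ∅ := by
      ext y
      simp only [Set.mem_iInter, Set.mem_empty_iff_false, iff_false, not_forall]
      exact ⟨‖y‖ + 1, fun h => by have : ‖y‖ + 1 ≤ ‖y‖ := h; linarith⟩
    rw [hempty, measure_empty] at h
    exact (ENNReal.tendsto_toReal ENNReal.zero_ne_top).comp h
  obtain ⟨v, hv⟩ : ∃ v, v = c * κ ^ d * volume.real (Metric.ball (0 : RSpace d) 1) := ⟨_, rfl⟩
  have hball0 : 0 < volume.real (Metric.ball (0 : RSpace d) 1) :=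
    ENNReal.toReal_pos (Metric.measure_ball_pos volume 0 one_pos).ne' measure_ball_lt_top.ne
  have hv0 : 0 < v := by rw [hv]; positivity
  -- The dilated ball has volume of order `‖x‖^d` and density at least `c p(x)`, so its target mass
  -- is at least `v w(x)`, `w` being the radial weight. It lies in `‖y‖ ≥ ‖x‖/2`, whose mass tends
  -- to `0`.
  have hbound : ∀ᶠ x in Bornology.cobounded (RSpace d),
      radialWeight p x ≤ v⁻¹ * (targetMeasure p).real {y | ‖x‖ * (1 / 2) ≤ ‖y‖} := by
    have h3 : ∀ᶠ x in Bornology.cobounded (RSpace d), 0 < ‖x‖ :=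
      (tendsto_norm_cobounded_atTop (E := RSpace d)).eventually_gt_atTop 0
    filter_upwards [hball, h3] with x hx hnx
    obtain ⟨z0, hz0⟩ := hx
    have hpx := hp0 x
    have hmem : ∀ y ∈ Metric.ball (‖x‖ • z0) (‖x‖ * κ), ‖x‖⁻¹ • y ∈ Metric.ball z0 κ := by
      intro y hy
      rw [mem_ball_iff_norm] at hy ⊢
      have e : ‖x‖⁻¹ • y - z0 = ‖x‖⁻¹ • (y - ‖x‖ • z0) := by
        rw [smul_sub, inv_smul_smul₀ hnx.ne']
      rw [e, norm_smul, norm_inv, norm_norm, inv_mul_lt_iff₀ hnx]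
      exact hy
    have hsub : Metric.ball (‖x‖ • z0) (‖x‖ * κ) ⊆ {y | ‖x‖ * (1 / 2) ≤ ‖y‖} := by
      intro y hy
      have h4 := (hz0 _ (hmem y hy)).1
      rw [norm_smul, norm_inv, norm_norm, le_inv_mul_iff₀ hnx] at h4
      exact h4
    have h5 : ENNReal.ofReal (c * p x) * volume (Metric.ball (‖x‖ • z0) (‖x‖ * κ)) ≤
        targetMeasure p (Metric.ball (‖x‖ • z0) (‖x‖ * κ)) := by
      unfold targetMeasure
      rw [withDensity_apply _ measurableSet_ball]
      calc _ = ∫⁻ _ in Metric.ball (‖x‖ • z0) (‖x‖ * κ), ENNReal.ofReal (c * p x) := by simp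
        _ ≤ _ := by
          refine setLIntegral_mono' measurableSet_ball fun y hy => ENNReal.ofReal_le_ofReal ?_
          have h6 := (hz0 _ (hmem y hy)).2
          rwa [smul_inv_smul₀ hnx.ne'] at h6
    have h7 := h5.trans (measure_mono hsub)
    have h8 := ENNReal.toReal_mono (measure_ne_top _ _) h7
    rw [Measure.addHaar_ball _ _ (by positivity), finrank_euclideanSpace, Fintype.card_fin,
      ENNReal.toReal_mul, ENNReal.toReal_mul, ENNReal.toReal_ofReal (by positivity),
      ENNReal.toReal_ofReal (by positivity)] at h8
    rw [← div_eq_inv_mul, le_div_iff₀ hv0, hv, radialWeight]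
    refine le_trans (le_of_eq ?_) h8
    rw [Measure.real, mul_pow]
    ring
  have hlim : Tendsto (fun x : RSpace d =>
      v⁻¹ * (targetMeasure p).real {y | ‖x‖ * (1 / 2) ≤ ‖y‖}) (Bornology.cobounded (RSpace d))
      (𝓝 0) := by
    have h1 := (htail.comp ((tendsto_norm_cobounded_atTop (E := RSpace d)).atTop_mul_const
      (by norm_num : (0 : ℝ) < 1 / 2))).const_mul v⁻¹
    simpa using h1
  exact tendsto_of_tendsto_of_tendsto_of_le_of_le' tendsto_const_nhds hlim
    (Eventually.of_forall fun x => radialWeight_nonneg hp0 x) hbound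

/-! ### Gluing the behaviours at the origin and at infinity -/

theorem exists_norm_bound_of_eventually_cobounded {Q : RSpace d → Prop}
    (h : ∀ᶠ x in Bornology.cobounded (RSpace d), Q x) : ∃ b : ℝ, ∀ x, b < ‖x‖ → Q x := by
  rw [← comap_norm_atTop, eventually_comap, eventually_atTop] at h
  obtain ⟨b, hb⟩ := h
  exact ⟨b, fun x hx => hb _ hx.le x rfl⟩

theorem exists_norm_bound_of_eventually_zero {Q : RSpace d → Prop}
    (h : ∀ᶠ x in 𝓝[≠] (0 : RSpace d), Q x) : ∃ a > 0, ∀ x, x ≠ 0 → ‖x‖ < a → Q x := by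
  rw [eventually_nhdsWithin_iff, Metric.eventually_nhds_iff] at h
  obtain ⟨a, ha, h⟩ := h
  exact ⟨a, ha, fun x hx0 hx => h (by simpa using hx) hx0⟩

/-- Near the origin `p` is almost constant, so the radial weight varies regularly with exponent `d ≠
0`. -/
theorem exists_driftRatio_le_zero (hd : 0 < d) (hρ0 : 0 < ρ) (hρ1 : ρ < 1)
    (hp : Measurable p) (hp0 : ∀ x, 0 < p x) (hcont : Continuous p) :
    ∃ r < 1, ∀ᶠ x in 𝓝[≠] (0 : RSpace d), driftRatio d ρ p x ≤ r := by
  refine exists_driftRatio_le_of_tendsto_rpow hd hρ0 hρ1 hp hp0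
    (eventually_mem_nhdsWithin.mono fun x hx => hx) (β := d) (by exact_mod_cast hd.ne') fun z hz => ?_
  have h1 : Tendsto (fun x : RSpace d => p (‖x‖ • z) / p x * ‖z‖ ^ d) (𝓝[≠] 0)
      (𝓝 (p (‖(0 : RSpace d)‖ • z) / p 0 * ‖z‖ ^ d)) := by
    refine Tendsto.mono_left (ContinuousAt.tendsto ?_) nhdsWithin_le_nhds
    have := (hp0 0).ne'
    fun_prop (disch := assumption)
  rw [norm_zero, zero_smul, div_self (hp0 0).ne', one_mul] at h1
  rw [Real.rpow_natCast]
  refine h1.congr' ?_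
  filter_upwards [eventually_mem_nhdsWithin] with x hx
  have hnx := norm_pos_iff.mpr (show x ≠ 0 from hx)
  have := hp0 x
  unfold radialWeight
  rw [norm_smul, norm_norm, mul_pow]
  field_simp

/-- Geometric ergodicity of the MpCN kernel from its behaviour at infinity. -/
theorem mpcnKernel_geometricallyErgodic (hd : 0 < d) (hρ0 : 0 < ρ) (hρ1 : ρ < 1)
    (hp : Measurable p) (hp0 : ∀ x, 0 < p x) (hcont : Continuous p)
    [IsProbabilityMeasure (targetMeasure p)]
    (hdrift : ∃ r < 1, ∀ᶠ x in Bornology.cobounded (RSpace d), driftRatio d ρ p x ≤ r)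
    {c κ : ℝ} (hc : 0 < c) (hκ : 0 < κ)
    (hball : ∀ᶠ x in Bornology.cobounded (RSpace d), ∃ z0 : RSpace d, ∀ z ∈ Metric.ball z0 κ,
      1 / 2 ≤ ‖z‖ ∧ c * p x ≤ p (‖x‖ • z)) :
    GeometricallyErgodic (mpcnKernel d ρ p hp) (targetMeasure p) := by
  have : Nonempty (Fin d) := ⟨⟨0, hd⟩⟩
  have hdecay := tendsto_radialWeight_cobounded hd hp0 hc hκ hball
  have hwc : Continuous (radialWeight p) := by unfold radialWeight; fun_prop
  have hdecay0 : Tendsto (radialWeight p) (𝓝[≠] 0) (𝓝 0) := by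
    have h : radialWeight p 0 = 0 := by simp [radialWeight, hd.ne']
    have h1 := (hwc.tendsto 0).mono_left (nhdsWithin_le_nhds (s := {0}ᶜ))
    rwa [h] at h1
  obtain ⟨r1, hr1, hinf⟩ := hdrift
  obtain ⟨r0, hr0, hzero⟩ := exists_driftRatio_le_zero hd hρ0 hρ1 hp hp0 hcont
  obtain ⟨b, hb⟩ := exists_norm_bound_of_eventually_cobounded hinf
  obtain ⟨a, ha, hza⟩ := exists_norm_bound_of_eventually_zero hzero
  obtain ⟨l, hl⟩ : ∃ l, l = max (max r0 r1) 0 := ⟨_, rfl⟩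
  have hl0 : 0 ≤ l := by rw [hl]; exact le_max_right _ _
  have hl1 : l < 1 := by rw [hl]; exact max_lt (max_lt hr0 hr1) one_pos
  have hlr0 : r0 ≤ l := by rw [hl]; exact (le_max_left _ _).trans (le_max_left _ _)
  have hlr1 : r1 ≤ l := by rw [hl]; exact (le_max_right _ _).trans (le_max_left _ _)
  have hVbd : ∃ M : ℝ, 0 ≤ M ∧ ∀ x : RSpace d, a ≤ ‖x‖ → ‖x‖ ≤ b → mpcnLyapunov p x ≤ M := by
    have hK : IsCompact (Metric.closedBall (0 : RSpace d) b ∩ {x | a ≤ ‖x‖}) :=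
      (isCompact_closedBall 0 b).inter_right (isClosed_le continuous_const continuous_norm)
    have hVc : ContinuousOn (mpcnLyapunov p)
        (Metric.closedBall (0 : RSpace d) b ∩ {x | a ≤ ‖x‖}) := by
      intro x hx
      have hx0 : x ≠ 0 := norm_pos_iff.mp (ha.trans_le hx.2)
      have h1 : √(radialWeight p x) ≠ 0 := (Real.sqrt_pos.mpr (radialWeight_pos hp0 hx0)).ne'
      have h2 : ContinuousAt (mpcnLyapunov p) x := by
        unfold mpcnLyapunov
        exact (Real.continuous_sqrt.comp hwc).continuousAt.inv₀ h1
      exact h2.continuousWithinAt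
    obtain ⟨M, hM⟩ := hK.bddAbove_image hVc
    refine ⟨max M 0, le_max_right _ _, fun x h1 h2 => le_trans ?_ (le_max_left _ _)⟩
    exact hM ⟨x, ⟨by simpa using h2, h1⟩, rfl⟩
  obtain ⟨M, hM0, hM⟩ := hVbd
  -- The origin is excluded because the proposal started there never moves. On the middle annulus
  -- the ratio is at most `5/4` and `V ≤ M`, whence the additive constant; the `+ 1` makes it
  -- positive even if `M = 0`.
  refine geometricallyErgodic_of_drift_of_minorization (S := {0}ᶜ) (V := mpcnLyapunov p)
    (l := l) (b := 5 / 4 * M + 1) (mpcnKernel_invariant hd hρ0 hρ1 hp hp0)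
    (measurableSet_singleton 0).compl ?_ ?_ (measurable_mpcnLyapunov hp) (mpcnLyapunov_nonneg p)
    hl0 hl1 (by positivity) ?_ ?_
  · intro x hx
    have hx : x ≠ 0 := hx
    rw [compl_compl]
    unfold mpcnKernel
    rw [mhKernel_apply, Measure.add_apply, Measure.smul_apply, mpcnProposal_eq_withDensity hρ0 hρ1 hx,
      Measure.dirac_apply' _ (measurableSet_singleton 0)]
    have h0 : (volume : Measure (RSpace d)) {0} = 0 := by simp
    have h1 : ((volume.withDensity fun y => ENNReal.ofReal (mpcnDensity d ρ x y)).withDensity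
        (acceptProb p (fun x => (‖x‖ ^ d)⁻¹) x)) {0} = 0 :=
      withDensity_absolutelyContinuous _ _ (withDensity_absolutelyContinuous _ _ h0)
    rw [h1]
    simp [hx]
  · rw [compl_compl]
    exact withDensity_absolutelyContinuous _ _ (by simp)
  · intro x hx
    have hx : x ≠ 0 := hx
    rw [lintegral_mpcnLyapunov hd hρ0 hρ1 hp hp0 hx]
    refine ENNReal.ofReal_le_ofReal ?_
    have hV0 := mpcnLyapunov_nonneg p x
    by_cases h1 : ‖x‖ < a
    · have := mul_le_mul_of_nonneg_right ((hza x hx h1).trans hlr0) hV0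
      linarith
    by_cases h2 : b < ‖x‖
    · have := mul_le_mul_of_nonneg_right ((hb x h2).trans hlr1) hV0
      linarith
    · have h3 := hM x (not_lt.mp h1) (not_lt.mp h2)
      have h4 := mul_le_mul_of_nonneg_right (driftRatio_le hd hρ0 hρ1 hp hp0 hx) hV0
      have h5 := mul_nonneg hl0 hV0
      linarith
  · intro R
    -- `V x ≤ R'` means that the radial weight is at least `R'^{-2}`; since the weight vanishes at
    -- both ends, this confines `x` to an annulus. The level `R` is arbitrary, so it is first made
    -- positive.
    obtain ⟨R', hR'⟩ : ∃ R', R' = max R 1 := ⟨_, rfl⟩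
    have hR'1 : 1 ≤ R' := by rw [hR']; exact le_max_right _ _
    have hR'0 : 0 < R' := by linarith
    obtain ⟨b', hb'⟩ := exists_norm_bound_of_eventually_cobounded
      (hdecay.eventually_lt_const (u := (R' ^ 2)⁻¹) (by positivity))
    obtain ⟨a', ha', hza'⟩ := exists_norm_bound_of_eventually_zero
      (hdecay0.eventually_lt_const (u := (R' ^ 2)⁻¹) (by positivity))
    obtain ⟨ν, hν0, hν⟩ := exists_minorization_annulus hd hρ0 hρ1 hp hp0 hcont ha'
      (b := max b' (a' + 1)) (lt_max_of_lt_right (by linarith))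
    refine ⟨ν, hν0, fun x hx hVx => ?_⟩
    have hx : x ≠ 0 := hx
    have hwx := radialWeight_pos hp0 hx
    have hge : (R' ^ 2)⁻¹ ≤ radialWeight p x := by
      have h1 : (√(radialWeight p x))⁻¹ ≤ R' := by
        refine le_trans hVx ?_
        rw [hR']; exact le_max_left _ _
      have h2 : R'⁻¹ ≤ √(radialWeight p x) := inv_le_of_inv_le₀ (Real.sqrt_pos.mpr hwx) h1
      rw [Real.le_sqrt (by positivity) hwx.le, inv_pow] at h2
      exact h2
    refine hν x ?_ ?_
    · by_contra h
      exact absurd (hza' x hx (not_le.mp h)) (not_lt.mpr hge)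
    · by_contra h
      exact absurd (hb' x ((le_max_left _ _).trans_lt (not_le.mp h))) (not_lt.mpr hge)

/-! ### The two classes of targets -/

theorem HeavyTailedClass.geometricallyErgodic (hd : 0 < d) (hρ0 : 0 < ρ) (hρ1 : ρ < 1)
    (hp : Measurable p) [IsProbabilityMeasure (targetMeasure p)] (h : HeavyTailedClass p) :
    GeometricallyErgodic (mpcnKernel d ρ p hp) (targetMeasure p) := by
  obtain ⟨hp0, hcont, e, he, α, hα, hlim⟩ := h
  have hdR : (0 : ℝ) < d := by exact_mod_cast hd
  have hα0 : 0 < α := hdR.trans hα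
  have hnorm := tendsto_norm_cobounded_atTop (E := RSpace d)
  have h3 : ∀ᶠ x in Bornology.cobounded (RSpace d), 0 < ‖x‖ := hnorm.eventually_gt_atTop 0
  obtain ⟨K, hK⟩ : ∃ K : Set (RSpace d), K = Metric.closedBall 0 2 ∩ {x | 1 ≤ ‖x‖} := ⟨_, rfl⟩
  have hKc : IsCompact K := by
    rw [hK]
    exact (isCompact_closedBall 0 2).inter_right (isClosed_le continuous_const continuous_norm)
  have hK0 : K ⊆ {0}ᶜ := by
    rw [hK]
    rintro x hx rfl
    have : (1 : ℝ) ≤ ‖(0 : RSpace d)‖ := hx.2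
    rw [norm_zero] at this
    linarith
  have hunif := (tendstoLocallyUniformlyOn_iff_forall_isCompact isOpen_compl_singleton).mp hlim
    K hK0 hKc
  rw [Metric.tendstoUniformlyOn_iff] at hunif
  -- Uniformity of the limit over the unit sphere makes `p` asymptotically radial, so the reference
  -- point `‖x‖ e` can be replaced by `x`.
  have hdir : Tendsto (fun x : RSpace d => p x / p (‖x‖ • e)) (Bornology.cobounded (RSpace d))
      (𝓝 1) := by
    rw [Metric.tendsto_nhds]
    intro ε hε
    filter_upwards [hnorm.eventually (hunif ε hε), h3] with x hx hnx
    have hx0 := norm_pos_iff.mp hnx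
    have hmem : ‖x‖⁻¹ • x ∈ K := by
      rw [hK]
      have := norm_inv_norm_smul hx0
      refine ⟨?_, this.ge⟩
      rw [mem_closedBall_zero_iff, this]; norm_num
    have h4 := hx _ hmem
    rw [norm_inv_norm_smul hx0, Real.one_rpow, smul_inv_smul₀ hnx.ne', dist_comm] at h4
    exact h4
  -- The ball of radius `1/4` around `(5/4) x/‖x‖` stays in `1 ≤ ‖z‖ ≤ 2`. There `p(‖x‖z)` exceeds
  -- `2^{-α}/2` times `p(‖x‖e)`, which in turn exceeds `p(x)/2`.
  refine mpcnKernel_geometricallyErgodic hd hρ0 hρ1 hp hp0 hcont ?_ (c := 2 ^ (-α) / 4) (κ := 1 / 4)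
    (by positivity) (by norm_num) ?_
  · have hcg := isCountablyGenerated_cobounded (d := d)
    refine exists_driftRatio_le_of_tendsto_rpow hd hρ0 hρ1 hp hp0
      (h3.mono fun x hx => norm_pos_iff.mp hx) (β := -α + d) (by linarith) fun z hz => ?_
    have h4 := (hlim.tendsto_at (show z ∈ ({0}ᶜ : Set (RSpace d)) from hz)).comp hnorm
    have h5 := (h4.div hdir one_ne_zero).mul_const (‖z‖ ^ d)
    rw [div_one] at h5
    rw [Real.rpow_add (norm_pos_iff.mpr hz), Real.rpow_natCast]
    refine h5.congr' ?_
    filter_upwards [h3] with x hnx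
    have hpx := hp0 x
    have hpe := hp0 (‖x‖ • e)
    simp only [Function.comp_apply, Pi.div_apply]
    unfold radialWeight
    rw [norm_smul, norm_norm, mul_pow]
    field_simp
  · have hε : (0 : ℝ) < 2 ^ (-α) / 2 := by positivity
    filter_upwards [hnorm.eventually (hunif _ hε), h3,
      hdir.eventually_lt_const (u := 2) (by norm_num)] with x hx hnx hx2
    have hx0 := norm_pos_iff.mp hnx
    have hpx := hp0 x
    have hpe := hp0 (‖x‖ • e)
    refine ⟨(5 / 4 : ℝ) • ‖x‖⁻¹ • x, fun z hz => ?_⟩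
    have hcn : ‖(5 / 4 : ℝ) • ‖x‖⁻¹ • x‖ = 5 / 4 := by
      rw [norm_smul, norm_inv_norm_smul hx0]; norm_num
    have hz1 : |‖z‖ - 5 / 4| < 1 / 4 := by
      rw [← hcn]
      exact (abs_norm_sub_norm_le _ _).trans_lt (mem_ball_iff_norm.mp hz)
    rw [abs_lt] at hz1
    have hzK : z ∈ K := by
      rw [hK]
      refine ⟨?_, ?_⟩
      · rw [mem_closedBall_zero_iff]; linarith
      · change 1 ≤ ‖z‖; linarith
    refine ⟨by linarith, ?_⟩
    have h4 := hx z hzK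
    rw [Real.dist_eq, abs_lt] at h4
    have h5 : (2 : ℝ) ^ (-α) ≤ ‖z‖ ^ (-α) :=
      Real.rpow_le_rpow_of_nonpos (by linarith) (by linarith) (by linarith)
    have h6 : 2 ^ (-α) / 2 < p (‖x‖ • z) / p (‖x‖ • e) := by linarith
    rw [lt_div_iff₀ hpe] at h6
    rw [div_lt_iff₀ hpe] at hx2
    have h7 : (0 : ℝ) < 2 ^ (-α) := by positivity
    have h8 := mul_lt_mul_of_pos_left hx2 (by positivity : (0 : ℝ) < 2 ^ (-α) / 4)
    linarith

/-- The curvature ball serves twice: it provides the strict drift at infinity and, with `c = 1`, the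
decay of the radial weight. -/
theorem LightTailedClass.geometricallyErgodic (hd : 0 < d) (hρ0 : 0 < ρ) (hρ1 : ρ < 1)
    (hp : Measurable p) [IsProbabilityMeasure (targetMeasure p)] (h : LightTailedClass p) :
    GeometricallyErgodic (mpcnKernel d ρ p hp) (targetMeasure p) := by
  obtain ⟨hp0, hdiff, hrv, hcurv⟩ := h
  obtain ⟨κ, hκ, hball⟩ := exists_ball_of_curvature hp0 hdiff hcurv
  refine mpcnKernel_geometricallyErgodic hd hρ0 hρ1 hp hp0 hdiff.continuous
    (exists_driftRatio_le_of_rapidlyVarying hd hρ0 hρ1 hp hp0 hrv hκ hball) one_pos hκ ?_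
  filter_upwards [hball] with x hx
  obtain ⟨z0, hz0⟩ := hx
  exact ⟨z0, fun z hz => ⟨(hz0 z hz).1, by rw [one_mul]; exact (hz0 z hz).2.2⟩⟩

end Assembly

theorem mainTheorem1 (d : ℕ) (hd : 2 ≤ d) (ρ : ℝ) (hρ0 : 0 < ρ) (hρ1 : ρ < 1)
    (p : RSpace d → ℝ) (hp : Measurable p) (hprob : IsProbabilityMeasure (targetMeasure p))
    (hclass : HeavyTailedClass p ∨ LightTailedClass p) :
    GeometricallyErgodic (mpcnKernel d ρ p hp) (targetMeasure p) := by
  have hd0 : 0 < d := by omega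
  rcases hclass with h | h
  · exact h.geometricallyErgodic hd0 hρ0 hρ1 hp
  · exact h.geometricallyErgodic hd0 hρ0 hρ1 hp
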